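/- Let $\mathbb K$ be a field of characteristic zero; rings and algebras are associative and unital. **Rings with involution.** An *$R$-ring with involution* is a ring $A$ with a ring homomorphism $\rho_A:R\to A$ and an additive map $*:A\to A$ with $(ab)^*=b^*a^*$, $a^{**}=a$ and $\rho_A(r)^*=\rho_A(r)$; a *map* of $R$-rings with involution is a ring homomorphism $k$ with $k\circ\rho_A=\rho_B$ and $k(a^*)=k(a)^*$. **TGW algebras.** Let $R$ be a $\mathbb K$-algebra, $I$ a set, $\sigma=(\sigma_i)_{i\in I}$ commuting $\mathbb K$-algebra automorphisms of $R$, $t=(t_i)_{i\in I}$ nonzero central elements of $R$, and $\mu=(\mu_{ij})_{i\ne j}$ with $\mu_{ij}\in\mathbb K\setminus\{0\}$. Let $\mathcal C=\mathcal C_\mu(R,\sigma,t)$ be the $R$-ring generated by $X_i,Y_i$ $(i\in I)$ with relations $X_ir=\sigma_i(r)X_i$, $Y_ir=\sigma_i^{-1}(r)Y_i$, $Y_iX_i=t_i$, $X_iY_i=\sigma_i(t_i)$, and $X_iY_j=\mu_{ij}Y_jX_i$ for $i\neq j$. It is graded by the free abelian group $\mathbb ZI$ with $\deg X_i=i$,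 $\deg Y_i=-i$, $\deg r=0$. The TGW algebra $\mathcal A_\mu(R,\sigma,t)$ is the quotient of $\mathcal C$ by the sum of all graded two-sided ideals $J$ with $J\cap\mathcal C_0=0$, with the induced grading. It is *consistent* if the canonical map $\rho:R\to\mathcal A_\mu(R,\sigma,t)$ is injective. If $R$ is commutative and $\mu_{ij}=\mu_{ji}$ for all $i\ne j$, it is an $R$-ring with involution via $X_i^*=Y_i$, $Y_i^*=X_i$, $r^*=r$. **Weyl algebra.** For a set $E$ let $R_E=\mathbb K[u_e\mid e\in E]$, and let $A_E(\mathbb K)$ be the $\mathbb K$-algebra generated by $x_e,y_e$ $(e\in E)$ with relations $[x_e,x_f]=[y_e,y_f]=0$, $[y_e,x_f]=\delta_{ef}$. It is an $R_E$-ring with involution via $u_e\mapsto y_ex_e$ and $x_e^*=y_e$, $y_e^*=x_e$. For $k\in\mathbb ZE$ put $z^k=\prod_{e}z_e^{(k_e)}$, where $z_e^{(p)}=x_e^p$ if $p\ge0$ and $z_e^{(p)}=y_e^{-p}$ if $p<0$. **Multiquivers.** A multiquiver $\Gamma=(V,E,s,t)$ consists of sets $V,E$ and functions $s,t:E\to(V\times\mathbb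 Z_{>0})\cup\{\emptyset\}$ such that $s(e)=(u,m)$, $t(e)=(v,n)$ imply $u\ne v$, and for each $v\in V$ the sets $s^{-1}(\{v\}\times\mathbb Z_{>0})$ and $t^{-1}(\{v\}\times\mathbb Z_{>0})$ are finite. Put $\gamma_{ev}=n$ if $t(e)=(v,n)$, $\gamma_{ev}=-n$ if $s(e)=(v,n)$, and $\gamma_{ev}=0$ otherwise, and let $\gamma(v)=\sum_e\gamma_{ev}e\in\mathbb ZE$. Let $\mathcal A(\Gamma)$ be the TGW algebra $\mathcal A_\mu(R_E,\sigma,t)$ with index set $V$, all $\mu_{ij}=1$, $\sigma_v(u_e)=u_e-\gamma_{ev}$ and $t_v=\prod_{e:\gamma_{ev}\neq 0}u_{ev}$, where $u_{ev}=u_e(u_e+1)\cdots(u_e+\gamma_{ev}-1)$ if $\gamma_{ev}>0$ and $u_{ev}=(u_e-1)(u_e-2)\cdots(u_e-|\gamma_{ev}|)$ if $\gamma_{ev}<0$. Let $\varphi_\Gamma:\mathcal A(\Gamma)\to A_E(\mathbb K)$ be the unique map of $R_E$-rings with involution with $\varphi_\Gamma(X_v)=z^{\gamma(v)}$ and $\varphi_\Gamma(Y_v)=z^{-\gamma(v)}$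 for all $v\in V$. **Theorem.** Let $V$ and $E$ be sets, let $\mathcal A=\mathcal A_\mu(R_E,\sigma,t)$ be any TGW algebra with index set $V$ and base algebra $R_E$ such that $\mu_{ij}=\mu_{ji}$ for all $i\neq j$, and let $\varphi:\mathcal A\to A_E(\mathbb K)$ be a map of $R_E$-rings with involution. Then $\mathcal A$ is consistent, and there exist a multiquiver $\Gamma=(V,E,s,t)$ with vertex set $V$ and edge set $E$ and a map $\xi:\mathcal A\to\mathcal A(\Gamma)$ of $\mathbb ZV$-graded $R_E$-rings with involution such that $\varphi=\varphi_\Gamma\circ\xi$. Moreover, if $\varphi(X_i)\ne0$ for each $i\in V$, then the multiquiver $\Gamma$ with this property is unique, and $\mu_{ij}=1$ for all $i,j\in V$ with $i\neq j$. -/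

import Mathlib

namespace TGW

noncomputable section

/-! ### Rings with involution over a base ring -/

/-- The structure of an `R`-ring with involution on a ring `A`: a ring homomorphism `ρ : R → A`
and an additive, anti-multiplicative, involutive map `inv : A → A` fixing the image of `ρ`. -/
structure RingInvolution (R A : Type*) [Ring R] [Ring A] where
  ρ : R →+* A
  inv : A →+ A
  inv_mul : ∀ a b, inv (a * b) = inv b * inv a
  inv_inv : ∀ a, inv (inv a) = a
  inv_ρ : ∀ r, inv (ρ r) = ρ r

/-- A ring homomorphism `k : A → B` is a map of `R`-rings with involution. -/
def RingInvolution.IsMap {R A B : Type*} [Ring R] [Ring A] [Ring B]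
    (SA : RingInvolution R A) (SB : RingInvolution R B) (k : A →+* B) : Prop :=
  k.comp SA.ρ = SB.ρ ∧ ∀ a, k (SA.inv a) = SB.inv (k a)

/-! ### Twisted generalized Weyl data, constructions and algebras -/

/-- A twisted generalized Weyl datum `(R, σ, t)` over `K` with index set `I`. -/
structure Datum (K R I : Type*) [Field K] [Ring R] [Algebra K R] where
  σ : I → R ≃ₐ[K] R
  σ_comm : ∀ i j r, σ i (σ j r) = σ j (σ i r)
  t : I → R
  t_ne_zero : ∀ i, t i ≠ 0
  t_central : ∀ i r, t i * r = r * t i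

/-- Generators: the elements of the base algebra, and `X i`, `Y i` for `i : I`. -/
inductive Gen (R I : Type*)
  | base (r : R) : Gen R I
  | X (i : I) : Gen R I
  | Y (i : I) : Gen R I

section General

variable {K R I : Type*} [Field K] [Ring R] [Algebra K R]

/-- A generator, as an element of the free `K`-algebra on all generators. -/
abbrev fgen (K : Type*) {R I : Type*} [Field K] (g : Gen R I) : FreeAlgebra K (Gen R I) :=
  FreeAlgebra.ι K g

/-- The defining relations of the twisted generalized Weyl construction. The relations
`base_add`, `base_mul`, `base_scalar` say that `r ↦ base r` is a homomorphism of `K`-algebras, so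
that the quotient by them is the free `R`-ring on the `X i`, `Y i` in which `K` is central. (In the
quotient of the free `R`-ring by the remaining relations `K` is central automatically, since each
`σ i` is `K`-linear.) The entries `μ i i` are not used. -/
inductive Rel (D : Datum K R I) (μ : I → I → K) :
    FreeAlgebra K (Gen R I) → FreeAlgebra K (Gen R I) → Prop
  | base_add (r s : R) : Rel D μ (fgen K (.base (r + s))) (fgen K (.base r) + fgen K (.base s))
  | base_mul (r s : R) : Rel D μ (fgen K (.base (r * s))) (fgen K (.base r) * fgen K (.base s))
  | base_scalar (c : K) : Rel D μ (fgen K (.base (algebraMap K R c))) (algebraMap K _ c)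
  | X_base (i : I) (r : R) :
      Rel D μ (fgen K (.X i) * fgen K (.base r)) (fgen K (.base (D.σ i r)) * fgen K (.X i))
  | Y_base (i : I) (r : R) :
      Rel D μ (fgen K (.Y i) * fgen K (.base r)) (fgen K (.base ((D.σ i).symm r)) * fgen K (.Y i))
  | YX (i : I) : Rel D μ (fgen K (.Y i) * fgen K (.X i)) (fgen K (.base (D.t i)))
  | XY (i : I) : Rel D μ (fgen K (.X i) * fgen K (.Y i)) (fgen K (.base (D.σ i (D.t i))))
  | XY_ne (i j : I) (h : i ≠ j) :
      Rel D μ (fgen K (.X i) * fgen K (.Y j)) (μ i j • (fgen K (.Y j) * fgen K (.X i)))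

/-- The twisted generalized Weyl construction `C_μ(R, σ, t)`. -/
def Constr (D : Datum K R I) (μ : I → I → K) : Type _ := RingQuot (Rel D μ)

instance (D : Datum K R I) (μ : I → I → K) : Ring (Constr D μ) :=
  inferInstanceAs (Ring (RingQuot (Rel D μ)))

instance (D : Datum K R I) (μ : I → I → K) : Algebra K (Constr D μ) :=
  inferInstanceAs (Algebra K (RingQuot (Rel D μ)))

/-- The quotient map from the free algebra. -/
def Constr.mk (D : Datum K R I) (μ : I → I → K) : FreeAlgebra K (Gen R I) →ₐ[K] Constr D μ :=
  RingQuot.mkAlgHom K (Rel D μ)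

theorem Constr.mk_surjective (D : Datum K R I) (μ : I → I → K) :
    Function.Surjective (Constr.mk D μ) :=
  RingQuot.mkAlgHom_surjective K (Rel D μ)

theorem Constr.mk_rel {D : Datum K R I} {μ : I → I → K} {a b : FreeAlgebra K (Gen R I)}
    (h : Rel D μ a b) : Constr.mk D μ a = Constr.mk D μ b :=
  RingQuot.mkAlgHom_rel K h

/-- The image of a generator in `C_μ(R, σ, t)`. -/
def Constr.gen (D : Datum K R I) (μ : I → I → K) (g : Gen R I) : Constr D μ :=
  Constr.mk D μ (fgen K g)

/-- The degree of a generator in the free abelian group `ℤ I`. -/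
def Gen.deg {R I : Type*} : Gen R I → (I →₀ ℤ)
  | .base _ => 0
  | .X i => Finsupp.single i 1
  | .Y i => -Finsupp.single i 1

/-- The homogeneous component `C_d` of degree `d`: the `K`-span of all products of generators
whose degrees add up to `d`. -/
def Constr.comp (D : Datum K R I) (μ : I → I → K) (d : I →₀ ℤ) : Submodule K (Constr D μ) :=
  Submodule.span K {a | ∃ l : List (Gen R I),
    (l.map Gen.deg).sum = d ∧ a = (l.map (Constr.gen D μ)).prod}

/-- The left ideal `J` is a graded two-sided ideal with `J ∩ C_0 = 0`. (It is graded when every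
element of it is a sum of homogeneous elements of it.) -/
structure IsNullIdeal {D : Datum K R I} {μ : I → I → K} (J : Ideal (Constr D μ)) : Prop where
  twoSided : J.IsTwoSided
  graded : ∀ a ∈ J, a ∈ AddSubgroup.closure {b | b ∈ J ∧ ∃ d, b ∈ Constr.comp D μ d}
  zero_inter : ∀ a ∈ J, a ∈ Constr.comp D μ 0 → a = 0

/-- The sum of all graded two-sided ideals `J` of `C_μ(R, σ, t)` with `J ∩ C_0 = 0`. -/
def radical (D : Datum K R I) (μ : I → I → K) : Ideal (Constr D μ) :=
  sSup {J | IsNullIdeal J}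

instance radical_isTwoSided (D : Datum K R I) (μ : I → I → K) : (radical D μ).IsTwoSided where
  mul_mem_of_left {a} b ha := by
    unfold radical at ha ⊢
    rw [sSup_eq_iSup'] at ha
    induction ha using Submodule.iSup_induction' with
    | mem J x hx =>
      have := J.2.twoSided
      exact Submodule.mem_sSup_of_mem J.2 (J.1.mul_mem_right b hx)
    | zero => simp
    | add x y _ _ hx hy => rw [add_mul]; exact add_mem hx hy

/-- The twisted generalized Weyl algebra `A_μ(R, σ, t)`. -/
def Alg (D : Datum K R I) (μ : I → I → K) : Type _ := Constr D μ ⧸ radical D μ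

instance (D : Datum K R I) (μ : I → I → K) : Ring (Alg D μ) :=
  inferInstanceAs (Ring (Constr D μ ⧸ radical D μ))

instance (D : Datum K R I) (μ : I → I → K) : Algebra K (Alg D μ) :=
  inferInstanceAs (Algebra K (Constr D μ ⧸ radical D μ))

/-- The quotient map `C_μ(R, σ, t) → A_μ(R, σ, t)`. -/
def Alg.mk (D : Datum K R I) (μ : I → I → K) : Constr D μ →ₐ[K] Alg D μ :=
  Ideal.Quotient.mkₐ K (radical D μ)

/-- The generator `X i` of `A_μ(R, σ, t)`. -/
def Alg.X (D : Datum K R I) (μ : I → I → K) (i : I) : Alg D μ :=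
  Alg.mk D μ (Constr.gen D μ (.X i))

/-- The generator `Y i` of `A_μ(R, σ, t)`. -/
def Alg.Y (D : Datum K R I) (μ : I → I → K) (i : I) : Alg D μ :=
  Alg.mk D μ (Constr.gen D μ (.Y i))

/-- The homogeneous component of degree `d` of `A_μ(R, σ, t)`. -/
def Alg.comp (D : Datum K R I) (μ : I → I → K) (d : I →₀ ℤ) : Submodule K (Alg D μ) :=
  (Constr.comp D μ d).map (Alg.mk D μ).toLinearMap

/-- The canonical map `R → C_μ(R, σ, t)`. -/
def Constr.base (D : Datum K R I) (μ : I → I → K) : R →ₐ[K] Constr D μ :=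
  AlgHom.ofLinearMap
    { toFun := fun r => Constr.gen D μ (.base r)
      map_add' := fun r s => by
        simp only [Constr.gen, Constr.mk_rel (Rel.base_add (D := D) (μ := μ) r s), map_add]
      map_smul' := fun c r => by
        simp only [Constr.gen, Algebra.smul_def, RingHom.id_apply]
        rw [Constr.mk_rel (Rel.base_mul (D := D) (μ := μ) _ r), map_mul,
          Constr.mk_rel (Rel.base_scalar (D := D) (μ := μ) c), AlgHom.commutes] }
    (by
      have := Constr.mk_rel (Rel.base_scalar (D := D) (μ := μ) 1)
      simpa [Constr.gen] using this)
    (fun r s => by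
      simp only [Constr.gen, LinearMap.coe_mk, AddHom.coe_mk]
      rw [Constr.mk_rel (Rel.base_mul (D := D) (μ := μ) r s), map_mul])

/-- The canonical map `ρ : R → A_μ(R, σ, t)`. -/
def Alg.base (D : Datum K R I) (μ : I → I → K) : R →ₐ[K] Alg D μ :=
  (Alg.mk D μ).comp (Constr.base D μ)

/-- `A_μ(R, σ, t)` is consistent when the canonical map `ρ` is injective. -/
def IsConsistent (D : Datum K R I) (μ : I → I → K) : Prop :=
  Function.Injective (Alg.base D μ)

/-- A map between two twisted generalized Weyl algebras with the same index set is graded. -/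
def IsGradedMap {D D' : Datum K R I} {μ μ' : I → I → K} (f : Alg D μ →+* Alg D' μ') : Prop :=
  ∀ d, ∀ a ∈ Alg.comp D μ d, f a ∈ Alg.comp D' μ' d

end General

/-! ### The involution of a twisted generalized Weyl algebra with symmetric `μ` -/

section Involution

variable {K R I : Type*} [Field K] [CommRing R] [Algebra K R]

/-- The exchange of `X i` and `Y i`. -/
def Gen.swap {R I : Type*} : Gen R I → Gen R I
  | .base r => .base r
  | .X i => .Y i
  | .Y i => .X i

theorem Constr.gen_X_base (D : Datum K R I) (μ : I → I → K) (i : I) (r : R) :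
    Constr.gen D μ (.X i) * Constr.gen D μ (.base r) =
      Constr.gen D μ (.base (D.σ i r)) * Constr.gen D μ (.X i) := by
  simpa [Constr.gen] using Constr.mk_rel (Rel.X_base (D := D) (μ := μ) i r)

theorem Constr.gen_Y_base (D : Datum K R I) (μ : I → I → K) (i : I) (r : R) :
    Constr.gen D μ (.Y i) * Constr.gen D μ (.base r) =
      Constr.gen D μ (.base ((D.σ i).symm r)) * Constr.gen D μ (.Y i) := by
  simpa [Constr.gen] using Constr.mk_rel (Rel.Y_base (D := D) (μ := μ) i r)

theorem Constr.gen_YX (D : Datum K R I) (μ : I → I → K) (i : I) :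
    Constr.gen D μ (.Y i) * Constr.gen D μ (.X i) = Constr.gen D μ (.base (D.t i)) := by
  simpa [Constr.gen] using Constr.mk_rel (Rel.YX (D := D) (μ := μ) i)

theorem Constr.gen_XY (D : Datum K R I) (μ : I → I → K) (i : I) :
    Constr.gen D μ (.X i) * Constr.gen D μ (.Y i) = Constr.gen D μ (.base (D.σ i (D.t i))) := by
  simpa [Constr.gen] using Constr.mk_rel (Rel.XY (D := D) (μ := μ) i)

theorem Constr.gen_XY_ne (D : Datum K R I) (μ : I → I → K) (i j : I) (h : i ≠ j) :
    Constr.gen D μ (.X i) * Constr.gen D μ (.Y j) =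
      μ i j • (Constr.gen D μ (.Y j) * Constr.gen D μ (.X i)) := by
  simpa [Constr.gen] using Constr.mk_rel (Rel.XY_ne (D := D) (μ := μ) i j h)

theorem Constr.flip_rel (D : Datum K R I) (μ : I → I → K) (hμ : ∀ i j, i ≠ j → μ i j = μ j i)
    ⦃a b : FreeAlgebra K (Gen R I)⦄ (h : Rel D μ a b) :
    FreeAlgebra.lift K (fun g => MulOpposite.op (Constr.gen D μ g.swap)) a =
      FreeAlgebra.lift K (fun g => MulOpposite.op (Constr.gen D μ g.swap)) b := by
  induction h with
  | base_add r s =>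
    simp only [map_add, FreeAlgebra.lift_ι_apply, Gen.swap, ← MulOpposite.op_add]
    exact congrArg MulOpposite.op ((Constr.base D μ).map_add r s)
  | base_mul r s =>
    simp only [map_mul, FreeAlgebra.lift_ι_apply, Gen.swap, ← MulOpposite.op_mul]
    rw [mul_comm r s]
    exact congrArg MulOpposite.op ((Constr.base D μ).map_mul s r)
  | base_scalar c =>
    simp only [FreeAlgebra.lift_ι_apply, Gen.swap, AlgHom.commutes,
      MulOpposite.algebraMap_apply]
    exact congrArg MulOpposite.op ((Constr.base D μ).commutes c)
  | X_base i r =>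
    simp only [map_mul, FreeAlgebra.lift_ι_apply, Gen.swap, ← MulOpposite.op_mul]
    rw [Constr.gen_Y_base, AlgEquiv.symm_apply_apply]
  | Y_base i r =>
    simp only [map_mul, FreeAlgebra.lift_ι_apply, Gen.swap, ← MulOpposite.op_mul]
    rw [Constr.gen_X_base, AlgEquiv.apply_symm_apply]
  | YX i =>
    simp only [map_mul, FreeAlgebra.lift_ι_apply, Gen.swap, ← MulOpposite.op_mul]
    rw [Constr.gen_YX]
  | XY i =>
    simp only [map_mul, FreeAlgebra.lift_ι_apply, Gen.swap, ← MulOpposite.op_mul]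
    rw [Constr.gen_XY]
  | XY_ne i j h =>
    simp only [map_mul, map_smul, FreeAlgebra.lift_ι_apply, Gen.swap, ← MulOpposite.op_mul,
      ← MulOpposite.op_smul]
    rw [Constr.gen_XY_ne D μ j i h.symm, hμ i j h]

/-- The anti-automorphism of `C_μ(R, σ, t)` exchanging `X i` and `Y i` and fixing `R`, as a
homomorphism to the opposite algebra. -/
def Constr.flip (D : Datum K R I) (μ : I → I → K) (hμ : ∀ i j, i ≠ j → μ i j = μ j i) :
    Constr D μ →ₐ[K] (Constr D μ)ᵐᵒᵖ :=
  RingQuot.liftAlgHom K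
    ⟨FreeAlgebra.lift K fun g => MulOpposite.op (Constr.gen D μ g.swap), Constr.flip_rel D μ hμ⟩

variable (D : Datum K R I) (μ : I → I → K) (hμ : ∀ i j, i ≠ j → μ i j = μ j i)

theorem Constr.flip_gen (g : Gen R I) :
    Constr.flip D μ hμ (Constr.gen D μ g) = MulOpposite.op (Constr.gen D μ g.swap) := by
  have h := RingQuot.liftAlgHom_mkAlgHom_apply K
    (FreeAlgebra.lift K fun g => MulOpposite.op (Constr.gen D μ (Gen.swap g)))
    (s := Rel D μ) (Constr.flip_rel D μ hμ) (fgen K g)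
  rw [FreeAlgebra.lift_ι_apply] at h
  exact h

/-- The involution of `C_μ(R, σ, t)`, for symmetric `μ`. -/
def Constr.inv : Constr D μ →ₗ[K] Constr D μ :=
  (MulOpposite.opLinearEquiv K).symm.toLinearMap ∘ₗ (Constr.flip D μ hμ).toLinearMap

theorem Constr.inv_gen (g : Gen R I) :
    Constr.inv D μ hμ (Constr.gen D μ g) = Constr.gen D μ g.swap := by
  simp [Constr.inv, Constr.flip_gen]

theorem Constr.inv_mul (a b : Constr D μ) :
    Constr.inv D μ hμ (a * b) = Constr.inv D μ hμ b * Constr.inv D μ hμ a := by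
  simp [Constr.inv]

theorem Constr.inv_algebraMap (c : K) :
    Constr.inv D μ hμ (algebraMap K _ c) = algebraMap K _ c := by
  simp [Constr.inv, MulOpposite.algebraMap_apply]

theorem Constr.inv_inv (a : Constr D μ) : Constr.inv D μ hμ (Constr.inv D μ hμ a) = a := by
  obtain ⟨a, rfl⟩ := Constr.mk_surjective D μ a
  induction a using FreeAlgebra.induction with
  | grade0 c => simp [AlgHom.commutes, Constr.inv_algebraMap]
  | grade1 g =>
    change Constr.inv D μ hμ (Constr.inv D μ hμ (Constr.gen D μ g)) = Constr.gen D μ g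
    rw [Constr.inv_gen, Constr.inv_gen]
    cases g <;> rfl
  | mul a b ha hb => rw [map_mul, Constr.inv_mul, Constr.inv_mul, ha, hb]
  | add a b ha hb => rw [map_add, map_add, map_add, ha, hb]

theorem Constr.inv_mem_comp {d : I →₀ ℤ} {a : Constr D μ} (ha : a ∈ Constr.comp D μ d) :
    Constr.inv D μ hμ a ∈ Constr.comp D μ (-d) := by
  unfold Constr.comp at ha
  induction ha using Submodule.span_induction with
  | mem a ha =>
    obtain ⟨l, rfl, rfl⟩ := ha
    refine Submodule.subset_span ⟨(l.map Gen.swap).reverse, ?_, ?_⟩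
    · rw [List.map_reverse, List.sum_reverse]
      induction l with
      | nil => simp
      | cons g l ih =>
        simp only [List.map_cons, List.sum_cons, ih, neg_add_rev]
        cases g <;> simp [Gen.swap, Gen.deg, add_comm]
    · induction l with
      | nil =>
        have := Constr.inv_algebraMap D μ hμ 1
        simpa using this
      | cons g l ih =>
        rw [List.map_cons, List.prod_cons, Constr.inv_mul, ih, Constr.inv_gen]
        simp
  | zero => simp
  | add a b _ _ ha hb => rw [map_add]; exact add_mem ha hb
  | smul c a _ ha => rw [map_smul]; exact Submodule.smul_mem _ c ha

/-- The image of a two-sided ideal under the involution. -/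
def invIdeal (J : Ideal (Constr D μ)) (hJ : J.IsTwoSided) : Ideal (Constr D μ) where
  carrier := {a | Constr.inv D μ hμ a ∈ J}
  add_mem' {a b} ha hb := by
    simp only [Set.mem_ofPred_eq, map_add] at ha hb ⊢
    exact add_mem ha hb
  zero_mem' := by simp
  smul_mem' c a ha := by
    simp only [Set.mem_ofPred_eq, smul_eq_mul, Constr.inv_mul] at ha ⊢
    exact J.mul_mem_right _ ha

theorem invIdeal_isNullIdeal (J : Ideal (Constr D μ)) (hJ : IsNullIdeal J) :
    IsNullIdeal (invIdeal D μ hμ J hJ.twoSided) where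
  twoSided := ⟨fun {a} b ha => by
    change Constr.inv D μ hμ (a * b) ∈ J
    rw [Constr.inv_mul]
    exact J.mul_mem_left _ ha⟩
  graded := by
    intro a ha
    have key : ∀ c ∈ AddSubgroup.closure {b | b ∈ J ∧ ∃ d, b ∈ Constr.comp D μ d},
        Constr.inv D μ hμ c ∈ AddSubgroup.closure
          {b | b ∈ invIdeal D μ hμ J hJ.twoSided ∧ ∃ d, b ∈ Constr.comp D μ d} := by
      intro c hc
      induction hc using AddSubgroup.closure_induction with
      | mem c hc =>
        obtain ⟨hc, d, hd⟩ := hc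
        refine AddSubgroup.subset_closure ⟨?_, -d, Constr.inv_mem_comp D μ hμ hd⟩
        change Constr.inv D μ hμ (Constr.inv D μ hμ c) ∈ J
        rwa [Constr.inv_inv]
      | zero => simp
      | add x y _ _ hx hy => rw [map_add]; exact add_mem hx hy
      | neg x _ hx => rw [map_neg]; exact neg_mem hx
    have := key _ (hJ.graded _ ha)
    rwa [Constr.inv_inv] at this
  zero_inter := by
    intro a ha h0
    have h1 := Constr.inv_mem_comp D μ hμ h0
    rw [neg_zero] at h1
    have := hJ.zero_inter _ ha h1
    rw [← Constr.inv_inv D μ hμ a, this, map_zero]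

theorem inv_mem_radical {a : Constr D μ} (ha : a ∈ radical D μ) :
    Constr.inv D μ hμ a ∈ radical D μ := by
  have hle : radical D μ ≤ invIdeal D μ hμ (radical D μ) (radical_isTwoSided D μ) := by
    refine sSup_le fun J hJ x hx => ?_
    refine Submodule.mem_sSup_of_mem (invIdeal_isNullIdeal D μ hμ J hJ) ?_
    change Constr.inv D μ hμ (Constr.inv D μ hμ x) ∈ J
    rwa [Constr.inv_inv]
  exact hle ha

/-- The involution of `A_μ(R, σ, t)`, for symmetric `μ`: it is the map induced by the involution
of `C_μ(R, σ, t)`, which exchanges `X i` and `Y i` and fixes `R`. -/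
def Alg.inv : Alg D μ →+ Alg D μ :=
  QuotientAddGroup.map (radical D μ).toAddSubgroup (radical D μ).toAddSubgroup
    (Constr.inv D μ hμ).toAddMonoidHom (fun _ ha => inv_mem_radical D μ hμ ha)

theorem Alg.mk_surjective : Function.Surjective (Alg.mk D μ) := Ideal.Quotient.mk_surjective

theorem Alg.inv_mk (a : Constr D μ) :
    Alg.inv D μ hμ (Alg.mk D μ a) = Alg.mk D μ (Constr.inv D μ hμ a) := rfl

theorem Alg.inv_X (i : I) : Alg.inv D μ hμ (Alg.X D μ i) = Alg.Y D μ i := by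
  rw [Alg.X, Alg.inv_mk, Constr.inv_gen]; rfl

theorem Alg.inv_Y (i : I) : Alg.inv D μ hμ (Alg.Y D μ i) = Alg.X D μ i := by
  rw [Alg.Y, Alg.inv_mk, Constr.inv_gen]; rfl

/-- `A_μ(R, σ, t)` as an `R`-ring with involution, for symmetric `μ`. -/
def Alg.ringInvolution : RingInvolution R (Alg D μ) where
  ρ := (Alg.base D μ).toRingHom
  inv := Alg.inv D μ hμ
  inv_mul a b := by
    obtain ⟨a, rfl⟩ := Alg.mk_surjective D μ a
    obtain ⟨b, rfl⟩ := Alg.mk_surjective D μ b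
    rw [← map_mul, Alg.inv_mk, Alg.inv_mk, Alg.inv_mk, Constr.inv_mul, map_mul]
  inv_inv a := by
    obtain ⟨a, rfl⟩ := Alg.mk_surjective D μ a
    rw [Alg.inv_mk, Alg.inv_mk, Constr.inv_inv]
  inv_ρ r := by
    change Alg.inv D μ hμ (Alg.mk D μ (Constr.gen D μ (.base r))) =
      Alg.mk D μ (Constr.gen D μ (.base r))
    rw [Alg.inv_mk, Constr.inv_gen]; rfl

end Involution

/-! ### The Weyl algebra -/

/-- Generators `x e`, `y e` of the Weyl algebra. -/
inductive WeylGen (E : Type*)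
  | x (e : E) : WeylGen E
  | y (e : E) : WeylGen E

section Weyl

/-- The defining relations of the Weyl algebra:
`[x_e, x_f] = [y_e, y_f] = 0` and `[y_e, x_f] = δ_{ef}`. -/
inductive WeylRel (K E : Type*) [Field K] :
    FreeAlgebra K (WeylGen E) → FreeAlgebra K (WeylGen E) → Prop
  | xx (e f : E) : WeylRel K E (FreeAlgebra.ι K (.x e) * FreeAlgebra.ι K (.x f))
      (FreeAlgebra.ι K (.x f) * FreeAlgebra.ι K (.x e))
  | yy (e f : E) : WeylRel K E (FreeAlgebra.ι K (.y e) * FreeAlgebra.ι K (.y f))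
      (FreeAlgebra.ι K (.y f) * FreeAlgebra.ι K (.y e))
  | yx (e : E) : WeylRel K E (FreeAlgebra.ι K (.y e) * FreeAlgebra.ι K (.x e))
      (FreeAlgebra.ι K (.x e) * FreeAlgebra.ι K (.y e) + 1)
  | yx_ne (e f : E) (h : e ≠ f) : WeylRel K E (FreeAlgebra.ι K (.y e) * FreeAlgebra.ι K (.x f))
      (FreeAlgebra.ι K (.x f) * FreeAlgebra.ι K (.y e))

/-- The Weyl algebra `A_E(K)` over `K` with index set `E`. -/
def Weyl (K E : Type*) [Field K] : Type _ := RingQuot (WeylRel K E)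

variable {K E : Type*} [Field K]

instance : Ring (Weyl K E) := inferInstanceAs (Ring (RingQuot (WeylRel K E)))

instance : Algebra K (Weyl K E) := inferInstanceAs (Algebra K (RingQuot (WeylRel K E)))

/-- The quotient map from the free algebra. -/
def Weyl.mk (K E : Type*) [Field K] : FreeAlgebra K (WeylGen E) →ₐ[K] Weyl K E :=
  RingQuot.mkAlgHom K (WeylRel K E)

theorem Weyl.mk_surjective : Function.Surjective (Weyl.mk K E) :=
  RingQuot.mkAlgHom_surjective K (WeylRel K E)

theorem Weyl.mk_rel {a b : FreeAlgebra K (WeylGen E)} (h : WeylRel K E a b) :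
    Weyl.mk K E a = Weyl.mk K E b :=
  RingQuot.mkAlgHom_rel K h

/-- The generator `x e` of the Weyl algebra. -/
def Weyl.x (K : Type*) {E : Type*} [Field K] (e : E) : Weyl K E :=
  Weyl.mk K E (FreeAlgebra.ι K (.x e))

/-- The generator `y e` of the Weyl algebra. -/
def Weyl.y (K : Type*) {E : Type*} [Field K] (e : E) : Weyl K E :=
  Weyl.mk K E (FreeAlgebra.ι K (.y e))

theorem Weyl.x_mul_x (e f : E) : Weyl.x K e * Weyl.x K f = Weyl.x K f * Weyl.x K e := by
  simpa [Weyl.x] using Weyl.mk_rel (WeylRel.xx (K := K) e f)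

theorem Weyl.y_mul_y (e f : E) : Weyl.y K e * Weyl.y K f = Weyl.y K f * Weyl.y K e := by
  simpa [Weyl.y] using Weyl.mk_rel (WeylRel.yy (K := K) e f)

theorem Weyl.y_mul_x (e : E) : Weyl.y K e * Weyl.x K e = Weyl.x K e * Weyl.y K e + 1 := by
  simpa [Weyl.x, Weyl.y] using Weyl.mk_rel (WeylRel.yx (K := K) e)

theorem Weyl.y_mul_x_ne {e f : E} (h : e ≠ f) :
    Weyl.y K e * Weyl.x K f = Weyl.x K f * Weyl.y K e := by
  simpa [Weyl.x, Weyl.y] using Weyl.mk_rel (WeylRel.yx_ne (K := K) e f h)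

/-- The exchange of `x e` and `y e`. -/
def Weyl.swapGen (K : Type*) {E : Type*} [Field K] : WeylGen E → Weyl K E
  | .x e => Weyl.y K e
  | .y e => Weyl.x K e

theorem Weyl.flip_rel ⦃a b : FreeAlgebra K (WeylGen E)⦄ (h : WeylRel K E a b) :
    FreeAlgebra.lift K (fun g => MulOpposite.op (Weyl.swapGen K g)) a =
      FreeAlgebra.lift K (fun g => MulOpposite.op (Weyl.swapGen K g)) b := by
  induction h with
  | xx e f =>
    simp only [map_mul, FreeAlgebra.lift_ι_apply, Weyl.swapGen, ← MulOpposite.op_mul]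
    rw [Weyl.y_mul_y]
  | yy e f =>
    simp only [map_mul, FreeAlgebra.lift_ι_apply, Weyl.swapGen, ← MulOpposite.op_mul]
    rw [Weyl.x_mul_x]
  | yx e =>
    simp only [map_mul, map_add, map_one, FreeAlgebra.lift_ι_apply, Weyl.swapGen, ← MulOpposite.op_mul]
    rw [Weyl.y_mul_x]; rfl
  | yx_ne e f h =>
    simp only [map_mul, FreeAlgebra.lift_ι_apply, Weyl.swapGen, ← MulOpposite.op_mul]
    rw [Weyl.y_mul_x_ne h.symm]

/-- The anti-automorphism of the Weyl algebra exchanging `x e` and `y e`, as a homomorphism to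
the opposite algebra. -/
def Weyl.flip (K E : Type*) [Field K] : Weyl K E →ₐ[K] (Weyl K E)ᵐᵒᵖ :=
  RingQuot.liftAlgHom K
    ⟨FreeAlgebra.lift K fun g => MulOpposite.op (Weyl.swapGen K g), Weyl.flip_rel⟩

theorem Weyl.flip_x (e : E) : Weyl.flip K E (Weyl.x K e) = MulOpposite.op (Weyl.y K e) := by
  refine (RingQuot.liftAlgHom_mkAlgHom_apply K _ (s := WeylRel K E) Weyl.flip_rel
    (FreeAlgebra.ι K (.x e))).trans ?_
  rw [FreeAlgebra.lift_ι_apply]; rfl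

theorem Weyl.flip_y (e : E) : Weyl.flip K E (Weyl.y K e) = MulOpposite.op (Weyl.x K e) := by
  refine (RingQuot.liftAlgHom_mkAlgHom_apply K _ (s := WeylRel K E) Weyl.flip_rel
    (FreeAlgebra.ι K (.y e))).trans ?_
  rw [FreeAlgebra.lift_ι_apply]; rfl

/-- The involution of the Weyl algebra. -/
def Weyl.inv (K E : Type*) [Field K] : Weyl K E →ₗ[K] Weyl K E :=
  (MulOpposite.opLinearEquiv K).symm.toLinearMap ∘ₗ (Weyl.flip K E).toLinearMap

theorem Weyl.inv_x (e : E) : Weyl.inv K E (Weyl.x K e) = Weyl.y K e := by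
  simp [Weyl.inv, Weyl.flip_x]

theorem Weyl.inv_y (e : E) : Weyl.inv K E (Weyl.y K e) = Weyl.x K e := by
  simp [Weyl.inv, Weyl.flip_y]

theorem Weyl.inv_mul (a b : Weyl K E) :
    Weyl.inv K E (a * b) = Weyl.inv K E b * Weyl.inv K E a := by
  simp [Weyl.inv]

theorem Weyl.inv_algebraMap (c : K) :
    Weyl.inv K E (algebraMap K _ c) = algebraMap K _ c := by
  simp [Weyl.inv, MulOpposite.algebraMap_apply]

theorem Weyl.inv_inv (a : Weyl K E) : Weyl.inv K E (Weyl.inv K E a) = a := by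
  obtain ⟨a, rfl⟩ := Weyl.mk_surjective a
  induction a using FreeAlgebra.induction with
  | grade0 c => simp [AlgHom.commutes, Weyl.inv_algebraMap]
  | grade1 g =>
    cases g with
    | x e =>
      change Weyl.inv K E (Weyl.inv K E (Weyl.x K e)) = Weyl.x K e
      rw [Weyl.inv_x, Weyl.inv_y]
    | y e =>
      change Weyl.inv K E (Weyl.inv K E (Weyl.y K e)) = Weyl.y K e
      rw [Weyl.inv_y, Weyl.inv_x]
  | mul a b ha hb => rw [map_mul, Weyl.inv_mul, Weyl.inv_mul, ha, hb]
  | add a b ha hb => rw [map_add, map_add, map_add, ha, hb]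

theorem Weyl.yx_comm (e f : E) :
    (Weyl.y K e * Weyl.x K e) * (Weyl.y K f * Weyl.x K f) =
      (Weyl.y K f * Weyl.x K f) * (Weyl.y K e * Weyl.x K e) := by
  by_cases h : e = f
  · rw [h]
  · have h1 : Commute (Weyl.y K e) (Weyl.y K f) := Weyl.y_mul_y e f
    have h2 : Commute (Weyl.x K e) (Weyl.x K f) := Weyl.x_mul_x e f
    have h3 : Commute (Weyl.y K e) (Weyl.x K f) := Weyl.y_mul_x_ne h
    have h4 : Commute (Weyl.x K e) (Weyl.y K f) := (Weyl.y_mul_x_ne (Ne.symm h)).symm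
    exact ((h1.mul_right h3).mul_left (h4.mul_right h2))

/-- The subalgebra generated by the commuting elements `y e * x e`. -/
abbrev Weyl.torus (K E : Type*) [Field K] : Subalgebra K (Weyl K E) :=
  Algebra.adjoin K (Set.range fun e : E => Weyl.y K e * Weyl.x K e)

instance Weyl.isMulCommutative_torus (K E : Type*) [Field K] :
    IsMulCommutative (Weyl.torus K E) :=
  Algebra.isMulCommutative_adjoin K (by
    rintro _ ⟨e, rfl⟩ _ ⟨f, rfl⟩
    exact Weyl.yx_comm e f)

open scoped IsMulCommutative in
/-- The homomorphism `R_E = K[u_e | e ∈ E] → A_E(K)` with `u_e ↦ y_e x_e`. -/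
def Weyl.base (K E : Type*) [Field K] : MvPolynomial E K →ₐ[K] Weyl K E :=
  (Weyl.torus K E).val.comp
    (MvPolynomial.aeval fun e : E =>
      (⟨Weyl.y K e * Weyl.x K e, Algebra.subset_adjoin ⟨e, rfl⟩⟩ : Weyl.torus K E))

open scoped IsMulCommutative in
theorem Weyl.base_X (e : E) :
    Weyl.base K E (MvPolynomial.X e) = Weyl.y K e * Weyl.x K e := by
  simp [Weyl.base]

theorem Weyl.inv_base (r : MvPolynomial E K) :
    Weyl.inv K E (Weyl.base K E r) = Weyl.base K E r := by
  induction r using MvPolynomial.induction_on with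
  | C c =>
    have : Weyl.base K E (MvPolynomial.C c) = algebraMap K _ c := (Weyl.base K E).commutes c
    rw [this, Weyl.inv_algebraMap]
  | add p q hp hq => rw [map_add, map_add, hp, hq]
  | mul_X p e hp =>
    rw [mul_comm, map_mul, Weyl.inv_mul, hp, Weyl.base_X, Weyl.inv_mul, Weyl.inv_x, Weyl.inv_y,
      ← Weyl.base_X, ← map_mul, ← map_mul, mul_comm]

/-- The Weyl algebra `A_E(K)` as an `R_E`-ring with involution. -/
def Weyl.ringInvolution (K E : Type*) [Field K] :
    RingInvolution (MvPolynomial E K) (Weyl K E) where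
  ρ := (Weyl.base K E).toRingHom
  inv := (Weyl.inv K E).toAddMonoidHom
  inv_mul := Weyl.inv_mul
  inv_inv := Weyl.inv_inv
  inv_ρ := Weyl.inv_base

/-- `z_e^{(p)}`, which is `x_e ^ p` for `p ≥ 0` and `y_e ^ (-p)` for `p < 0`. -/
def Weyl.zpart (K : Type*) {E : Type*} [Field K] (e : E) (p : ℤ) : Weyl K E :=
  if 0 ≤ p then Weyl.x K e ^ p.toNat else Weyl.y K e ^ (-p).toNat

theorem Weyl.zpart_commute {e f : E} (h : e ≠ f) (p q : ℤ) :
    Commute (Weyl.zpart K e p) (Weyl.zpart K f q) := by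
  have h1 : Commute (Weyl.y K e) (Weyl.y K f) := Weyl.y_mul_y e f
  have h2 : Commute (Weyl.x K e) (Weyl.x K f) := Weyl.x_mul_x e f
  have h3 : Commute (Weyl.y K e) (Weyl.x K f) := Weyl.y_mul_x_ne h
  have h4 : Commute (Weyl.x K e) (Weyl.y K f) := (Weyl.y_mul_x_ne (Ne.symm h)).symm
  unfold Weyl.zpart
  split_ifs
  · exact h2.pow_pow _ _
  · exact h4.pow_pow _ _
  · exact h3.pow_pow _ _
  · exact h1.pow_pow _ _

/-- `z^k = ∏_e z_e^{(k_e)}` for `k` in the free abelian group `ℤ E`. -/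
def Weyl.z (K : Type*) {E : Type*} [Field K] (k : E →₀ ℤ) : Weyl K E :=
  k.support.noncommProd (fun e => Weyl.zpart K e (k e))
    (fun _ _ _ _ h => Weyl.zpart_commute h _ _)

end Weyl

end

end TGW

/-! ### Multiquivers -/

/-- A multiquiver with vertex set `V` and edge set `E`: every edge has at most one source and at
most one target (`none` stands for the absence of one), each with a positive multiplicity, there
are no loops, and every vertex is the source, and the target, of only finitely many edges. -/
structure Multiquiver (V E : Type*) where
  s : E → Option (V × ℕ+)
  t : E → Option (V × ℕ+)
  no_loops : ∀ e u m v n, s e = some (u, m) → t e = some (v, n) → u ≠ v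
  finite_s : ∀ v, {e | ∃ n, s e = some (v, n)}.Finite
  finite_t : ∀ v, {e | ∃ n, t e = some (v, n)}.Finite

namespace Multiquiver

noncomputable section

variable {V E : Type*}

open Classical in
/-- The multiplicity of the vertex `v` in an end of an edge: `n` if the end is `(v, n)`, and `0`
otherwise. -/
def mult (v : V) : Option (V × ℕ+) → ℤ
  | none => 0
  | some (w, n) => if w = v then (n : ℤ) else 0

theorem mult_ne_zero {v : V} {o : Option (V × ℕ+)} (h : mult v o ≠ 0) :
    ∃ n, o = some (v, n) := by
  rcases o with _ | ⟨w, n⟩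
  · simp [mult] at h
  · by_cases hw : w = v
    · exact ⟨n, by rw [hw]⟩
    · simp [mult, hw] at h

/-- The column `γ(v) ∈ ℤ E` of the incidence matrix: the coefficient at `e` is `n` if
`t(e) = (v, n)`, it is `-n` if `s(e) = (v, n)`, and `0` otherwise. -/
def γ (Γ : Multiquiver V E) (v : V) : E →₀ ℤ :=
  Finsupp.onFinset ((Γ.finite_t v).union (Γ.finite_s v)).toFinset
    (fun e => mult v (Γ.t e) - mult v (Γ.s e)) (by
      intro e he
      rw [Set.Finite.mem_toFinset]
      by_cases h : mult v (Γ.t e) = 0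
      · right
        refine mult_ne_zero (fun h' => he ?_)
        rw [h, h', sub_zero]
      · left
        exact mult_ne_zero h)

/-- The polynomial `u_e (u_e + 1) ⋯ (u_e + n - 1)` for `n ≥ 0`, and
`(u_e - 1) (u_e - 2) ⋯ (u_e - |n|)` for `n < 0`. -/
def uFactor (K : Type*) [Field K] (e : E) (n : ℤ) : MvPolynomial E K :=
  if 0 ≤ n then ∏ k ∈ Finset.range n.toNat, (MvPolynomial.X e + MvPolynomial.C (k : K))
  else ∏ k ∈ Finset.range (-n).toNat, (MvPolynomial.X e - MvPolynomial.C ((k : K) + 1))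

theorem X_add_C_ne_zero {K : Type*} [Field K] (e : E) (c : K) :
    (MvPolynomial.X e + MvPolynomial.C c : MvPolynomial E K) ≠ 0 := by
  intro h
  have := congrArg (MvPolynomial.eval fun _ => 1 - c) h
  simp at this

theorem uFactor_ne_zero (K : Type*) [Field K] (e : E) (n : ℤ) : uFactor K e n ≠ 0 := by
  unfold uFactor
  split_ifs
  · exact Finset.prod_ne_zero_iff.2 fun k _ => X_add_C_ne_zero e _
  · refine Finset.prod_ne_zero_iff.2 fun k _ => ?_
    rw [sub_eq_add_neg, ← map_neg]
    exact X_add_C_ne_zero e _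

/-- The automorphism `u_e ↦ u_e - k_e` of `R_E = K[u_e | e ∈ E]`. -/
def shift (K : Type*) [Field K] (k : E → ℤ) : MvPolynomial E K ≃ₐ[K] MvPolynomial E K :=
  AlgEquiv.ofAlgHom
    (MvPolynomial.aeval fun e => MvPolynomial.X e - MvPolynomial.C (k e : K))
    (MvPolynomial.aeval fun e => MvPolynomial.X e + MvPolynomial.C (k e : K))
    (by ext e; simp)
    (by ext e; simp)

theorem shift_X (K : Type*) [Field K] (k : E → ℤ) (e : E) :
    shift K k (MvPolynomial.X e) = MvPolynomial.X e - MvPolynomial.C (k e : K) := by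
  simp [shift]

theorem shift_comm (K : Type*) [Field K] (k l : E → ℤ) (r : MvPolynomial E K) :
    shift K k (shift K l r) = shift K l (shift K k r) := by
  have : ((shift K k).toAlgHom.comp (shift K l).toAlgHom) =
      ((shift K l).toAlgHom.comp (shift K k).toAlgHom) := by
    apply MvPolynomial.algHom_ext
    intro e
    simp [shift]
    ring
  exact DFunLike.congr_fun this r

/-- The twisted generalized Weyl datum `(R_E, σ^Γ, t^Γ)` of a multiquiver `Γ`:
`σ_v(u_e) = u_e - γ_{ev}` and `t_v = ∏_{e incident to v} u_{ev}`. -/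
def datum (K : Type*) [Field K] (Γ : Multiquiver V E) : TGW.Datum K (MvPolynomial E K) V where
  σ v := shift K (Γ.γ v)
  σ_comm _ _ := shift_comm K _ _
  t v := ∏ e ∈ (Γ.γ v).support, uFactor K e (Γ.γ v e)
  t_ne_zero _ := Finset.prod_ne_zero_iff.2 fun e _ => uFactor_ne_zero K e _
  t_central _ _ := mul_comm _ _

/-- The twisted generalized Weyl algebra `A(Γ)`, for which all `μ i j` are `1`. -/
abbrev algebra (K : Type*) [Field K] (Γ : Multiquiver V E) : Type _ :=
  TGW.Alg (Γ.datum K) (fun _ _ => 1)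

/-- `A(Γ)` as an `R_E`-ring with involution. -/
abbrev ringInvolution (K : Type*) [Field K] (Γ : Multiquiver V E) :
    TGW.RingInvolution (MvPolynomial E K) (Γ.algebra K) :=
  TGW.Alg.ringInvolution (Γ.datum K) (fun _ _ => 1) (fun _ _ _ => rfl)

/-- `ψ` is the canonical representation `φ_Γ : A(Γ) → A_E(K)` by differential operators: the map
of `R_E`-rings with involution with `X_v ↦ z^{γ(v)}` and `Y_v ↦ z^{-γ(v)}` (and `u_e ↦ y_e x_e`,
because it is a map of `R_E`-rings). Since `A(Γ)` is generated by `R_E` and the `X_v`, `Y_v`,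
these conditions determine `ψ`. -/
structure IsCanonicalRep {K : Type*} [Field K] (Γ : Multiquiver V E)
    (ψ : Γ.algebra K →+* TGW.Weyl K E) : Prop where
  isMap : (Γ.ringInvolution K).IsMap (TGW.Weyl.ringInvolution K E) ψ
  map_X : ∀ v, ψ (TGW.Alg.X _ _ v) = TGW.Weyl.z K (Γ.γ v)
  map_Y : ∀ v, ψ (TGW.Alg.Y _ _ v) = TGW.Weyl.z K (-Γ.γ v)

/-- `φ` factors as `φ_Γ ∘ ξ` for a map `ξ : A_μ(R_E, σ, t) → A(Γ)` of `ℤ V`-graded `R_E`-rings with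
involution. -/
def Factors {K : Type*} [Field K] {D : TGW.Datum K (MvPolynomial E K) V} {μ : V → V → K}
    (hμ : ∀ i j, i ≠ j → μ i j = μ j i) (φ : TGW.Alg D μ →+* TGW.Weyl K E)
    (Γ : Multiquiver V E) : Prop :=
  ∃ φΓ : Γ.algebra K →+* TGW.Weyl K E, Γ.IsCanonicalRep φΓ ∧
    ∃ ξ : TGW.Alg D μ →+* Γ.algebra K,
      (TGW.Alg.ringInvolution D μ hμ).IsMap (Γ.ringInvolution K) ξ ∧
      TGW.IsGradedMap ξ ∧ φΓ.comp ξ = φ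

end

end Multiquiver

/-!
An element `a ≠ 0` of the Weyl algebra with `a r = σ(r) a` for all polynomials `r` has a single term
in its normal form `∑ c_k z^k`, because distinct `k` induce distinct shifts of the polynomial ring.
Hence `φ(X_i) = r_i z^{k_i}`. Letting both sides of `X_i Y_j = μ_ij Y_j X_i` act on `1` gives a
polynomial identity: leading coefficients force `μ_ij = 1`, and comparing the integral roots in
`u_e`, a finite set which shifts translate, forces `k_i(e) k_j(e) ≤ 0`. So at most one of the
numbers `k_i(e)` is positive and at most one is negative, which says that the `k_i` are the columns
of the incidence matrix of a multiquiver `Γ`. The assignment `X_i ↦ r_i X_i` respects the relations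
because they are homogeneous and `φ_Γ` is injective on homogeneous elements. Finally `k_i`, and with
it `Γ`, is read off from the shift by which `φ(X_i)` commutes with polynomials.
-/

namespace Multiquiver

open MvPolynomial

variable {K E : Type*} [Field K]

theorem shift_C (k : E → ℤ) (c : K) : shift K k (C c) = C c :=
  (shift K k).commutes c

theorem shift_shift (k l : E → ℤ) (r : MvPolynomial E K) :
    shift K k (shift K l r) = shift K (k + l) r := by
  have h : (shift K k).toAlgHom.comp (shift K l).toAlgHom = (shift K (k + l)).toAlgHom := by
    ext1 e
    change shift K k (shift K l (X e)) = shift K (k + l) (X e)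
    rw [shift_X, map_sub, shift_X, shift_C, shift_X, Pi.add_apply, Int.cast_add, map_add, sub_sub]
  exact DFunLike.congr_fun h r

theorem shift_zero (r : MvPolynomial E K) : shift K (0 : E → ℤ) r = r := by
  have h : (shift K (0 : E → ℤ)).toAlgHom = AlgHom.id K _ := by
    ext1 e
    simp [shift]
  exact DFunLike.congr_fun h r

theorem shift_shift_neg (k : E → ℤ) (r : MvPolynomial E K) :
    shift K k (shift K (-k) r) = r := by
  rw [shift_shift, add_neg_cancel, shift_zero]

theorem shift_symm (k : E → ℤ) (r : MvPolynomial E K) :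
    (shift K k).symm r = shift K (-k) r := by
  rw [AlgEquiv.symm_apply_eq, shift_shift_neg]

theorem shift_injective [CharZero K] :
    Function.Injective (shift K : (E → ℤ) → MvPolynomial E K ≃ₐ[K] MvPolynomial E K) := by
  intro k l h
  funext e
  have he := DFunLike.congr_fun h (X e)
  rw [shift_X, shift_X, sub_right_inj] at he
  exact_mod_cast C_injective E K he

theorem prod_uFactor_ne_zero (k : E →₀ ℤ) : ∏ e ∈ k.support, uFactor K e (k e) ≠ 0 :=
  Finset.prod_ne_zero_iff.2 fun e _ => uFactor_ne_zero K e (k e)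

end Multiquiver

/-! ### Weights and normal forms in the Weyl algebra -/

namespace TGW

noncomputable section

open MvPolynomial Multiquiver

variable {K E : Type*} [Field K]

section HasWeight

variable {A : Type*} [Ring A] [Algebra K A] {ρ : MvPolynomial E K →ₐ[K] A}
  {k l : E → ℤ} {v w : A}

/-- The element `w` of an algebra `A` over `R_E` has weight `k` when moving a polynomial across it
from the right to the left applies the shift `u_e ↦ u_e - k_e`. -/
def HasWeight (ρ : MvPolynomial E K →ₐ[K] A) (k : E → ℤ) (w : A) : Prop :=
  ∀ r, w * ρ r = ρ (shift K k r) * w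

namespace HasWeight

theorem of_X (h : ∀ e, w * ρ (X e) = ρ (X e - C (k e : K)) * w) : HasWeight ρ k w := by
  intro r
  induction r using MvPolynomial.induction_on with
  | C c =>
    have hc : ρ (C c) = algebraMap K A c := ρ.commutes c
    rw [shift_C, hc, Algebra.commutes]
  | add p q hp hq => simp only [map_add, mul_add, add_mul, hp, hq]
  | mul_X p e hp =>
    rw [map_mul, ← mul_assoc, hp, mul_assoc, h, map_mul, map_mul, shift_X, mul_assoc]

protected theorem base (r : MvPolynomial E K) : HasWeight ρ 0 (ρ r) := fun s => by
  rw [shift_zero, ← map_mul, ← map_mul, mul_comm]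

protected theorem one : HasWeight ρ 0 1 := map_one ρ ▸ HasWeight.base 1

protected theorem mul (hv : HasWeight ρ k v) (hw : HasWeight ρ l w) :
    HasWeight ρ (k + l) (v * w) := fun r => by
  rw [mul_assoc, hw, ← mul_assoc, hv, mul_assoc, shift_shift]

protected theorem pow (hw : HasWeight ρ k w) (n : ℕ) : HasWeight ρ (n • k) (w ^ n) := by
  induction n with
  | zero => simpa using HasWeight.one
  | succ n ih => simpa only [pow_succ, succ_nsmul] using ih.mul hw

end HasWeight

/-- The subspace of the elements of weight `k`. -/
def weightSpace (ρ : MvPolynomial E K →ₐ[K] A) (k : E → ℤ) : Submodule K A where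
  carrier := {w | HasWeight ρ k w}
  add_mem' hv hw r := by rw [add_mul, mul_add, hv, hw]
  zero_mem' r := by rw [zero_mul, mul_zero]
  smul_mem' c w hw r := by rw [smul_mul_assoc, mul_smul_comm, hw]

end HasWeight

namespace Weyl

theorem base_C (c : K) : base K E (C c) = algebraMap K _ c := (base K E).commutes c

theorem x_mul_y (e : E) : x K e * y K e = base K E (X e - 1) := by
  rw [map_sub, base_X, map_one, y_mul_x, add_sub_cancel_right]

theorem hasWeight_x (e : E) : HasWeight (base K E) (Finsupp.single e (1 : ℤ)) (x K e) := by
  refine HasWeight.of_X fun f => ?_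
  by_cases h : e = f
  · subst h
    rw [base_X, ← mul_assoc, x_mul_y]
    simp
  · rw [Finsupp.single_eq_of_ne (Ne.symm h), Int.cast_zero, map_zero, sub_zero, base_X,
      ← mul_assoc, ← y_mul_x_ne (Ne.symm h), mul_assoc, x_mul_x, mul_assoc]

theorem hasWeight_y (e : E) : HasWeight (base K E) (Finsupp.single e (-1 : ℤ)) (y K e) := by
  refine HasWeight.of_X fun f => ?_
  by_cases h : e = f
  · subst h
    rw [base_X, y_mul_x, mul_add, ← mul_assoc, y_mul_x]
    simp [base_X, y_mul_x, add_mul]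
  · rw [Finsupp.single_eq_of_ne (Ne.symm h), Int.cast_zero, map_zero, sub_zero, base_X,
      ← mul_assoc, y_mul_y, mul_assoc, y_mul_x_ne h, mul_assoc]

theorem zpart_zero (e : E) : zpart K e 0 = 1 := by simp [zpart]

theorem zpart_natCast (e : E) (n : ℕ) : zpart K e n = x K e ^ n := by simp [zpart]

theorem zpart_neg_natCast (e : E) (n : ℕ) : zpart K e (-n) = y K e ^ n := by
  rcases n.eq_zero_or_pos with rfl | h
  · simp [zpart]
  · rw [zpart, if_neg (by omega), neg_neg, Int.toNat_natCast]

theorem hasWeight_zpart (e : E) (n : ℤ) :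
    HasWeight (base K E) (Finsupp.single e n) (zpart K e n) := by
  obtain ⟨n, rfl | rfl⟩ := n.eq_nat_or_neg
  · simpa [zpart_natCast, ← Finsupp.coe_smul] using (hasWeight_x e).pow n
  · simpa [zpart_neg_natCast, ← Finsupp.coe_smul] using (hasWeight_y e).pow n

theorem z_zero : z K (0 : E →₀ ℤ) = 1 := by simp [z]

theorem z_single_add {e : E} {n : ℤ} {k : E →₀ ℤ} (he : e ∉ k.support) :
    z K (Finsupp.single e n + k) = zpart K e n * z K k := by
  classical
  rcases eq_or_ne n 0 with rfl | hn
  · simp [zpart_zero]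
  have hs : (Finsupp.single e n + k).support = insert e k.support := by
    ext f
    by_cases h : f = e
    · subst h; simp_all
    · simp [h]
  refine (Finset.noncommProd_congr hs (fun _ _ => rfl) _).trans ?_
  refine (Finset.noncommProd_insert_of_notMem _ _ _ _ he).trans ?_
  congr 1
  · simp_all
  · refine Finset.noncommProd_congr rfl (fun f hf => ?_) _
    have : f ≠ e := fun h => he (h ▸ hf)
    simp [this]

theorem zpart_mul_z_erase (e : E) (n : ℤ) (k : E →₀ ℤ) :
    zpart K e n * z K (k.erase e) = z K (Finsupp.single e n + k.erase e) :=
  (z_single_add (by simp)).symm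

theorem z_eq_zpart_mul (e : E) (k : E →₀ ℤ) :
    z K k = zpart K e (k e) * z K (k.erase e) := by
  rw [zpart_mul_z_erase, Finsupp.single_add_erase]

theorem hasWeight_z (k : E →₀ ℤ) : HasWeight (base K E) k (z K k) := by
  induction k using Finsupp.induction with
  | zero => simpa [z_zero] using HasWeight.one
  | single_add e n k he _ ih =>
    rw [z_single_add he, Finsupp.coe_add]
    exact (hasWeight_zpart e n).mul ih

theorem zpart_commute_z {e : E} {k : E →₀ ℤ} (he : e ∉ k.support) (n : ℤ) :
    Commute (zpart K e n) (z K k) := by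
  refine Finset.noncommProd_commute _ _ _ _ fun f hf => zpart_commute ?_ _ _
  rintro rfl
  exact he hf

theorem zpart_commute_of_nonneg {e : E} {m n : ℤ} (h : 0 ≤ m * n) :
    Commute (zpart K e m) (zpart K e n) := by
  have hzero {m n : ℕ} (h : 0 ≤ -((m : ℤ) * n)) : m = 0 ∨ n = 0 := by
    rw [← mul_eq_zero]
    exact_mod_cast le_antisymm (neg_nonneg.1 h) (by positivity)
  obtain ⟨m, rfl | rfl⟩ := m.eq_nat_or_neg <;> obtain ⟨n, rfl | rfl⟩ := n.eq_nat_or_neg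
  · simpa only [zpart_natCast] using Commute.pow_pow_self _ m n
  · rcases hzero (mul_neg (m : ℤ) n ▸ h) with rfl | rfl <;> simp [zpart_zero]
  · rcases hzero (neg_mul (m : ℤ) n ▸ h) with rfl | rfl <;> simp [zpart_zero]
  · simpa only [zpart_neg_natCast] using Commute.pow_pow_self _ m n

theorem z_commute {k l : E →₀ ℤ} (h : ∀ e, 0 ≤ k e * l e) : Commute (z K k) (z K l) := by
  refine Finset.noncommProd_commute _ _ _ _ fun f _ => Commute.symm ?_
  refine Finset.noncommProd_commute _ _ _ _ fun e _ => Commute.symm ?_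
  rcases eq_or_ne e f with rfl | hef
  · exact zpart_commute_of_nonneg (h e)
  · exact zpart_commute hef _ _

theorem inv_one : inv K E 1 = 1 := by
  simpa using inv_algebraMap (K := K) (E := E) 1

theorem inv_pow (a : Weyl K E) (n : ℕ) : inv K E (a ^ n) = inv K E a ^ n := by
  induction n with
  | zero => simp [inv_one]
  | succ n ih => rw [pow_succ, inv_mul, ih, pow_succ']

theorem inv_zpart (e : E) (n : ℤ) : inv K E (zpart K e n) = zpart K e (-n) := by
  obtain ⟨n, rfl | rfl⟩ := n.eq_nat_or_neg
  · rw [zpart_natCast, inv_pow, inv_x, zpart_neg_natCast]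
  · rw [neg_neg, zpart_neg_natCast, inv_pow, inv_y, zpart_natCast]

theorem inv_z (k : E →₀ ℤ) : inv K E (z K k) = z K (-k) := by
  induction k using Finsupp.induction with
  | zero => simp [z_zero, inv_one]
  | single_add e n k he _ ih =>
    have he' : e ∉ (-k).support := by rwa [Finsupp.support_neg]
    rw [z_single_add he, inv_mul, ih, inv_zpart, neg_add, ← Finsupp.single_neg,
      z_single_add he', (zpart_commute_z he' _).eq]

theorem y_pow_mul_x_pow (e : E) (m : ℕ) :
    y K e ^ m * x K e ^ m = base K E (∏ k ∈ Finset.range m, (X e + C (k : K))) := by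
  induction m with
  | zero => simp
  | succ m ih =>
    calc y K e ^ (m + 1) * x K e ^ (m + 1)
        = y K e ^ m * base K E (X e) * x K e ^ m := by
          rw [pow_succ, pow_succ', base_X]; simp only [mul_assoc]
      _ = base K E (X e + C (m : K)) * (y K e ^ m * x K e ^ m) := by
          rw [(hasWeight_y e).pow, shift_X, mul_assoc]; simp
      _ = _ := by rw [ih, ← map_mul, Finset.prod_range_succ, mul_comm]

theorem x_pow_mul_y_pow (e : E) (m : ℕ) :
    x K e ^ m * y K e ^ m = base K E (∏ k ∈ Finset.range m, (X e - C ((k : K) + 1))) := by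
  induction m with
  | zero => simp
  | succ m ih =>
    calc x K e ^ (m + 1) * y K e ^ (m + 1)
        = x K e ^ m * base K E (X e - 1) * y K e ^ m := by
          rw [pow_succ, pow_succ', ← x_mul_y]; simp only [mul_assoc]
      _ = base K E (X e - C ((m : K) + 1)) * (x K e ^ m * y K e ^ m) := by
          rw [(hasWeight_x e).pow, map_sub, map_one, shift_X, mul_assoc]; simp [sub_sub]
      _ = _ := by rw [ih, ← map_mul, Finset.prod_range_succ, mul_comm]

theorem zpart_neg_mul_zpart (e : E) (n : ℤ) :
    zpart K e (-n) * zpart K e n = base K E (uFactor K e n) := by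
  obtain ⟨n, rfl | rfl⟩ := n.eq_nat_or_neg
  · rw [zpart_neg_natCast, zpart_natCast, y_pow_mul_x_pow]
    simp [uFactor]
  · rw [neg_neg, zpart_neg_natCast, zpart_natCast, x_pow_mul_y_pow]
    rcases n.eq_zero_or_pos with rfl | h
    · simp [uFactor]
    · rw [uFactor, if_neg (by omega), neg_neg, Int.toNat_natCast]

theorem z_neg_mul_z (k : E →₀ ℤ) :
    z K (-k) * z K k = base K E (∏ e ∈ k.support, uFactor K e (k e)) := by
  change _ = base K E (k.prod fun e n => uFactor K e n)
  induction k using Finsupp.induction with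
  | zero => simp [z_zero]
  | single_add e n k he hn ih =>
    have he' : e ∉ (-k).support := by rwa [Finsupp.support_neg]
    have hu : uFactor K e 0 = 1 := by simp [uFactor]
    have hdisj : Disjoint (Finsupp.single e n).support k.support := by
      rw [Finsupp.support_single _ hn]
      simpa using he
    rw [Finsupp.prod_add_index_of_disjoint hdisj, Finsupp.prod_single_index hu, map_mul, ← ih,
      ← zpart_neg_mul_zpart, z_single_add he, neg_add, ← Finsupp.single_neg, z_single_add he',
      mul_assoc, ← mul_assoc (z K (-k)), ← (zpart_commute_z he' n).eq]
    simp only [mul_assoc]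

/-- The linear map sending a finitely supported family `c` of coefficients to `∑ c_k z^k`. -/
def normalForm (K E : Type*) [Field K] : ((E →₀ ℤ) →₀ MvPolynomial E K) →ₗ[K] Weyl K E :=
  Finsupp.lsum K fun k => LinearMap.mulRight K (z K k) ∘ₗ (base K E).toLinearMap

theorem normalForm_single (k : E →₀ ℤ) (r : MvPolynomial E K) :
    normalForm K E (Finsupp.single k r) = base K E r * z K k := by
  simp [normalForm]

theorem x_mul_zpart (e : E) (n : ℤ) :
    ∃ q, x K e * zpart K e n = base K E q * zpart K e (n + 1) := by
  obtain ⟨n, rfl | rfl⟩ := n.eq_nat_or_neg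
  · refine ⟨1, ?_⟩
    rw [map_one, one_mul, zpart_natCast, ← pow_succ', ← zpart_natCast, Nat.cast_succ]
  · cases n with
    | zero => exact ⟨1, by simp [zpart]⟩
    | succ n =>
      refine ⟨X e - 1, ?_⟩
      rw [zpart_neg_natCast, pow_succ', ← mul_assoc, x_mul_y, Nat.cast_succ, neg_add,
        neg_add_cancel_right, zpart_neg_natCast]

theorem y_mul_zpart (e : E) (n : ℤ) :
    ∃ q, y K e * zpart K e n = base K E q * zpart K e (n - 1) := by
  obtain ⟨n, rfl | rfl⟩ := n.eq_nat_or_neg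
  · cases n with
    | zero => exact ⟨1, by simp [zpart]⟩
    | succ n =>
      refine ⟨X e, ?_⟩
      rw [zpart_natCast, pow_succ', ← mul_assoc, base_X, Nat.cast_succ, add_sub_cancel_right,
        zpart_natCast]
  · refine ⟨1, ?_⟩
    rw [map_one, one_mul, zpart_neg_natCast, ← pow_succ', ← zpart_neg_natCast, Nat.cast_succ,
      neg_add']

theorem mul_mem_range_normalForm_of_zpart {l : E → ℤ} {w : Weyl K E} (hw : HasWeight (base K E) l w)
    {e : E} {m : ℤ}
    (hm : ∀ n : ℤ, ∃ q, w * zpart K e n = base K E q * zpart K e (n + m))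
    {a : Weyl K E} (ha : a ∈ LinearMap.range (normalForm K E)) :
    w * a ∈ LinearMap.range (normalForm K E) := by
  obtain ⟨c, rfl⟩ := ha
  induction c using Finsupp.induction_linear with
  | zero => simp
  | add c d hc hd => rw [map_add, mul_add]; exact add_mem hc hd
  | single k r =>
    obtain ⟨q, hq⟩ := hm (k e)
    refine ⟨Finsupp.single (Finsupp.single e (k e + m) + k.erase e) (shift K l r * q), ?_⟩
    rw [normalForm_single, normalForm_single, z_eq_zpart_mul e k, ← mul_assoc, hw, mul_assoc,
      ← mul_assoc w, hq, mul_assoc, zpart_mul_z_erase, map_mul, mul_assoc]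

theorem mul_mem_range_normalForm (a : Weyl K E) {b : Weyl K E}
    (hb : b ∈ LinearMap.range (normalForm K E)) : a * b ∈ LinearMap.range (normalForm K E) := by
  obtain ⟨a, rfl⟩ := mk_surjective a
  induction a using FreeAlgebra.induction generalizing b with
  | grade0 c =>
    rw [AlgHom.commutes, ← Algebra.smul_def]
    exact Submodule.smul_mem _ c hb
  | grade1 g =>
    cases g with
    | x e => exact mul_mem_range_normalForm_of_zpart (hasWeight_x e) (x_mul_zpart e) hb
    | y e => exact mul_mem_range_normalForm_of_zpart (hasWeight_y e) (y_mul_zpart e) hb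
  | mul a₁ a₂ h₁ h₂ => rw [map_mul, mul_assoc]; exact h₁ (h₂ hb)
  | add a₁ a₂ h₁ h₂ => rw [map_add, add_mul]; exact add_mem (h₁ hb) (h₂ hb)

theorem normalForm_surjective : Function.Surjective (normalForm K E) := fun a => by
  have h1 : (1 : Weyl K E) ∈ LinearMap.range (normalForm K E) :=
    ⟨Finsupp.single 0 1, by simp [normalForm_single, z_zero]⟩
  simpa using mul_mem_range_normalForm a h1

/-- The operators on `R_E` by which the generators of the Weyl algebra act. -/
def actGen (K : Type*) {E : Type*} [Field K] : WeylGen E → Module.End K (MvPolynomial E K)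
  | .x e => (shift K (Finsupp.single e (1 : ℤ))).toLinearMap
  | .y e => LinearMap.mulLeft K (X e) * (shift K (Finsupp.single e (-1 : ℤ))).toLinearMap

theorem shift_single_X_of_ne {e f : E} (h : e ≠ f) (n : ℤ) :
    shift K (Finsupp.single e n) (X f) = X f := by
  rw [shift_X, Finsupp.single_eq_of_ne h.symm, Int.cast_zero, map_zero, sub_zero]

theorem actGen_rel ⦃a b : FreeAlgebra K (WeylGen E)⦄ (h : WeylRel K E a b) :
    FreeAlgebra.lift K (actGen K) a = FreeAlgebra.lift K (actGen K) b := by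
  refine LinearMap.ext fun p => ?_
  induction h with
  | xx e f => simp [actGen, shift_comm K (Finsupp.single e (1 : ℤ))]
  | yy e f =>
    rcases eq_or_ne e f with rfl | hef
    · rfl
    · simp only [actGen, map_mul, FreeAlgebra.lift_ι_apply, Module.End.mul_apply,
        LinearMap.mulLeft_apply, AlgEquiv.toLinearMap_apply, shift_single_X_of_ne hef,
        shift_single_X_of_ne hef.symm]
      rw [shift_comm K (Finsupp.single e (-1 : ℤ)), mul_left_comm]
  | yx e =>
    simp [actGen, shift_shift, shift_X, shift_zero, sub_mul]
  | yx_ne e f h =>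
    simp [actGen, shift_comm K (Finsupp.single f (1 : ℤ)), shift_single_X_of_ne h.symm]

/-- The action of the Weyl algebra on `R_E` in which `x_e` is the shift `u_e ↦ u_e - 1` and
`y_e x_e` is multiplication by `u_e`. -/
def act (K E : Type*) [Field K] : Weyl K E →ₐ[K] Module.End K (MvPolynomial E K) :=
  RingQuot.liftAlgHom K ⟨FreeAlgebra.lift K (actGen K), actGen_rel⟩

theorem act_mk (a : FreeAlgebra K (WeylGen E)) :
    act K E (mk K E a) = FreeAlgebra.lift K (actGen K) a :=
  RingQuot.liftAlgHom_mkAlgHom_apply K _ (s := WeylRel K E) actGen_rel a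

theorem act_x (e : E) (p : MvPolynomial E K) :
    act K E (x K e) p = shift K (Finsupp.single e (1 : ℤ)) p := by
  rw [x, act_mk, FreeAlgebra.lift_ι_apply]; rfl

theorem act_y (e : E) (p : MvPolynomial E K) :
    act K E (y K e) p = X e * shift K (Finsupp.single e (-1 : ℤ)) p := by
  rw [y, act_mk, FreeAlgebra.lift_ι_apply]; rfl

theorem act_base (r p : MvPolynomial E K) : act K E (base K E r) p = r * p := by
  induction r using MvPolynomial.induction_on generalizing p with
  | C c => rw [base_C, AlgHom.commutes, Module.algebraMap_end_apply, C_mul']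
  | add q r hq hr => rw [map_add, map_add, LinearMap.add_apply, hq, hr, add_mul]
  | mul_X q e hq =>
    rw [map_mul, map_mul, Module.End.mul_apply, hq, base_X, map_mul, Module.End.mul_apply, act_y,
      act_x, shift_shift, ← Finsupp.coe_add, ← Finsupp.single_add, mul_assoc]
    simp [shift_zero]

theorem base_injective : Function.Injective (base K E) := fun r s h => by
  simpa [act_base] using congrArg (fun w => act K E w 1) h

theorem act_apply_of_hasWeight {k : E → ℤ} {a : Weyl K E} (ha : HasWeight (base K E) k a)
    (p : MvPolynomial E K) : act K E a p = act K E a 1 * shift K k p := by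
  simpa [act_base, mul_comm] using congrArg (fun w => act K E w 1) (ha p)

theorem act_one_mul_shift_of_mul_eq_smul {k l : E → ℤ} {a b : Weyl K E}
    (ha : HasWeight (base K E) k a) (hb : HasWeight (base K E) l b) {c : K}
    (h : a * b = c • (b * a)) :
    act K E a 1 * shift K k (act K E b 1) = C c * (act K E b 1 * shift K l (act K E a 1)) := by
  have h1 := congrArg (fun w => act K E w 1) h
  simp only [map_mul, map_smul, Module.End.mul_apply, LinearMap.smul_apply] at h1
  rwa [act_apply_of_hasWeight ha (act K E b 1), act_apply_of_hasWeight hb (act K E a 1),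
    smul_eq_C_mul] at h1

/-- The polynomial by which `z^k` acts, up to the shift by `k`; it is nonzero, and it is a multiple
of `u_e` when `y_e` occurs in `z^k`. -/
def zCoeff (K : Type*) {E : Type*} [Field K] (k : E →₀ ℤ) : MvPolynomial E K := act K E (z K k) 1

theorem act_z (k : E →₀ ℤ) (p : MvPolynomial E K) :
    act K E (z K k) p = zCoeff K k * shift K k p :=
  act_apply_of_hasWeight (hasWeight_z k) p

theorem act_base_mul_z (r : MvPolynomial E K) (k : E →₀ ℤ) (p : MvPolynomial E K) :
    act K E (base K E r * z K k) p = r * zCoeff K k * shift K k p := by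
  rw [map_mul, Module.End.mul_apply, act_base, act_z, mul_assoc]

theorem zCoeff_ne_zero (k : E →₀ ℤ) : zCoeff K k ≠ 0 := fun h => by
  have h1 := congrArg (fun w => act K E w 1) (z_neg_mul_z (K := K) k)
  simp only [map_mul, Module.End.mul_apply, act_z, h, zero_mul, map_zero, act_base,
    mul_one] at h1
  exact prod_uFactor_ne_zero k h1.symm

theorem X_dvd_zCoeff {e : E} {k : E →₀ ℤ} (h : k e < 0) : X e ∣ zCoeff K k := by
  obtain ⟨n, hn⟩ : ∃ n : ℕ, k e = -(n + 1 : ℕ) := ⟨(-k e).toNat - 1, by omega⟩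
  rw [zCoeff, z_eq_zpart_mul e, hn, zpart_neg_natCast, pow_succ', mul_assoc, map_mul,
    Module.End.mul_apply, act_y]
  exact dvd_mul_right _ _

theorem base_mul_z_left_injective (k : E →₀ ℤ) :
    Function.Injective fun r => base K E r * z K k := fun r s h => by
  have h1 := congrArg (fun w => act K E w 1) h
  simp only [act_base_mul_z, map_one, mul_one] at h1
  exact mul_right_cancel₀ (zCoeff_ne_zero k) h1

theorem z_mul_z_neg (k : E →₀ ℤ) :
    z K k * z K (-k) = base K E (shift K k (∏ e ∈ k.support, uFactor K e (k e))) := by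
  have hneg := z_neg_mul_z (K := K) (-k)
  rw [neg_neg] at hneg
  rw [hneg]
  refine congrArg (base K E) (base_mul_z_left_injective k ?_)
  simp only
  rw [← hneg, mul_assoc, z_neg_mul_z, hasWeight_z]

section CharZero

variable [CharZero K]

/-- Dedekind's independence of characters, applied to the pairwise distinct shifts. -/
theorem linearIndependent_shift : LinearIndependent (MvPolynomial E K)
    fun k : E →₀ ℤ => (shift K k : MvPolynomial E K → MvPolynomial E K) :=
  (linearIndependent_monoidHom (MvPolynomial E K) (MvPolynomial E K)).comp
    (fun k : E →₀ ℤ => (shift K k : MvPolynomial E K →* MvPolynomial E K))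
    fun _ _ h => DFunLike.coe_injective <| shift_injective <| AlgEquiv.ext fun r =>
      DFunLike.congr_fun h r

theorem normalForm_injective : Function.Injective (normalForm K E) := by
  rw [injective_iff_map_eq_zero]
  intro c hc
  have hsum : ∑ k ∈ c.support, (c k * zCoeff K k) •
      (shift K k : MvPolynomial E K → MvPolynomial E K) = 0 := by
    funext p
    have hp := congrArg (fun w => act K E w p) hc
    simpa [normalForm, Finsupp.sum, act_base, act_z, mul_assoc] using hp
  ext1 k
  by_contra hk
  have := linearIndependent_iff'.1 linearIndependent_shift _ _ hsum k (Finsupp.mem_support_iff.2 hk)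
  exact mul_ne_zero hk (zCoeff_ne_zero k) this

/-- The coefficients of an element of the Weyl algebra in its normal form `∑ c_k z^k`. -/
def coeff (K E : Type*) [Field K] [CharZero K] :
    Weyl K E ≃ₗ[K] ((E →₀ ℤ) →₀ MvPolynomial E K) :=
  (LinearEquiv.ofBijective (normalForm K E) ⟨normalForm_injective, normalForm_surjective⟩).symm

theorem coeff_normalForm (c : (E →₀ ℤ) →₀ MvPolynomial E K) :
    coeff K E (normalForm K E c) = c :=
  LinearEquiv.ofBijective_symm_apply_apply ..

theorem coeff_base_mul (r : MvPolynomial E K) (a : Weyl K E) (k : E →₀ ℤ) :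
    coeff K E (base K E r * a) k = r * coeff K E a k := by
  obtain ⟨c, rfl⟩ := normalForm_surjective a
  induction c using Finsupp.induction_linear with
  | zero => simp
  | add c d hc hd => simp only [map_add, mul_add, Finsupp.add_apply, hc, hd]
  | single l s =>
    rw [normalForm_single, ← mul_assoc, ← map_mul, ← normalForm_single, ← normalForm_single,
      coeff_normalForm, coeff_normalForm]
    by_cases h : l = k <;> simp [h]

theorem coeff_mul_base (a : Weyl K E) (r : MvPolynomial E K) (k : E →₀ ℤ) :
    coeff K E (a * base K E r) k = shift K k r * coeff K E a k := by
  obtain ⟨c, rfl⟩ := normalForm_surjective a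
  induction c using Finsupp.induction_linear with
  | zero => simp
  | add c d hc hd => simp only [map_add, add_mul, mul_add, Finsupp.add_apply, hc, hd]
  | single l s =>
    rw [normalForm_single, mul_assoc, hasWeight_z, ← mul_assoc, ← map_mul, ← normalForm_single,
      ← normalForm_single, coeff_normalForm, coeff_normalForm]
    by_cases h : l = k <;> simp [h, mul_comm]

theorem isLeftRegular_base {r : MvPolynomial E K} (hr : r ≠ 0) :
    IsLeftRegular (base K E r) := fun a b h => by
  refine (coeff K E).injective (Finsupp.ext fun k => mul_left_cancel₀ hr ?_)
  rw [← coeff_base_mul, ← coeff_base_mul]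
  exact congrArg (fun w => coeff K E w k) h

theorem weight_unique {k l : E → ℤ} {a : Weyl K E} (hk : HasWeight (base K E) k a)
    (hl : HasWeight (base K E) l a) (ha : a ≠ 0) : k = l := by
  refine shift_injective (K := K) (AlgEquiv.ext fun r => ?_)
  by_contra hne
  refine ha ((isLeftRegular_base (sub_ne_zero.2 hne)).mul_left_eq_zero_iff.1 ?_)
  rw [map_sub, sub_mul, ← hk, ← hl, sub_self]

theorem isLeftRegular_z (k : E →₀ ℤ) : IsLeftRegular (z K k) := by
  refine IsLeftRegular.of_mul (a := z K (-k)) ?_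
  rw [z_neg_mul_z]
  exact isLeftRegular_base (prod_uFactor_ne_zero k)

theorem exists_eq_base_mul_z {a : Weyl K E} (ha : a ≠ 0)
    (σ : MvPolynomial E K ≃ₐ[K] MvPolynomial E K)
    (h : ∀ r, a * base K E r = base K E (σ r) * a) :
    ∃ (k : E →₀ ℤ) (r : MvPolynomial E K), σ = shift K k ∧ a = base K E r * z K k := by
  have hσ {k : E →₀ ℤ} (hk : coeff K E a k ≠ 0) : σ = shift K k := AlgEquiv.ext fun r =>
    mul_right_cancel₀ hk <| by rw [← coeff_mul_base, h, coeff_base_mul]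
  obtain ⟨k, hk⟩ := Finsupp.ne_iff.1 ((coeff K E).map_ne_zero_iff.2 ha)
  refine ⟨k, coeff K E a k, hσ hk, (coeff K E).injective ?_⟩
  rw [← normalForm_single, coeff_normalForm]
  ext1 l
  by_cases hl : k = l
  · rw [hl, Finsupp.single_eq_same]
  · rw [Finsupp.single_eq_of_ne (Ne.symm hl)]
    by_contra hl0
    exact hl (DFunLike.coe_injective (shift_injective ((hσ hk).symm.trans (hσ hl0))))

end CharZero

end Weyl

end

end TGW

/-! ### Twisted commutation of polynomials -/

namespace Multiquiver

open MvPolynomial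
open scoped MonomialOrder

variable {K E : Type*} [Field K]

theorem shift_monomial (k : E → ℤ) (s : E →₀ ℕ) (a : K) :
    shift K k (monomial s a) = C a * s.prod fun e n => (X e - C (k e : K)) ^ n := by
  rw [monomial_eq, map_mul, shift_C, Finsupp.prod, map_prod]
  simp only [map_pow, shift_X, Finsupp.prod]

theorem degree_shift_monomial (m : MonomialOrder E) (k : E → ℤ) (s : E →₀ ℕ) {a : K} (ha : a ≠ 0) :
    m.degree (shift K k (monomial s a)) = s := by
  have hne (e : E) : (X e - C (k e : K) : MvPolynomial E K) ≠ 0 := (m.monic_X_sub_C e _).ne_zero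
  rw [shift_monomial, Finsupp.prod, m.degree_mul (C_ne_zero.2 ha)
    (Finset.prod_ne_zero_iff.2 fun e _ => pow_ne_zero _ (hne e)), m.degree_C, zero_add,
    m.degree_prod fun e _ => pow_ne_zero _ (hne e)]
  simp only [m.degree_pow, m.degree_X_sub_C, Finsupp.smul_single, smul_eq_mul, mul_one]
  exact s.sum_single

theorem leadingCoeff_shift_monomial (m : MonomialOrder E) (k : E → ℤ) (s : E →₀ ℕ) (a : K) :
    m.leadingCoeff (shift K k (monomial s a)) = a := by
  have hmonic : m.Monic (s.prod fun e n => (X e - C (k e : K)) ^ n) :=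
    MonomialOrder.Monic.prod fun e _ => (m.monic_X_sub_C e _).pow
  rw [shift_monomial, m.leadingCoeff_mul, m.leadingCoeff_C, hmonic.leadingCoeff_eq_one, mul_one]

theorem degree_leadingCoeff_shift (m : MonomialOrder E) (k : E → ℤ) (p : MvPolynomial E K) :
    m.degree (shift K k p) = m.degree p ∧ m.leadingCoeff (shift K k p) = m.leadingCoeff p := by
  induction h : m.toSyn (m.degree p) using WellFoundedLT.induction generalizing p with
  | ind d ih =>
    subst h
    rcases eq_or_ne (m.degree p) 0 with h0 | h0
    · rw [m.eq_C_of_degree_eq_zero h0, shift_C]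
      exact ⟨rfl, rfl⟩
    have hlc : m.leadingCoeff p ≠ 0 := by
      rw [Ne, m.leadingCoeff_eq_zero_iff]
      rintro rfl
      exact h0 m.degree_zero
    have hdeg : m.degree (shift K k (m.leadingTerm p)) = m.degree p :=
      degree_shift_monomial m k _ hlc
    have hlt := m.degree_sub_leadingTerm_lt_degree h0
    have hrest : m.degree (shift K k (p - m.leadingTerm p)) ≺[m]
        m.degree (shift K k (m.leadingTerm p)) := by
      rwa [(ih _ hlt _ rfl).1, hdeg]
    have hsplit : shift K k p = shift K k (m.leadingTerm p) + shift K k (p - m.leadingTerm p) := by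
      rw [← map_add, add_sub_cancel]
    rw [hsplit, m.degree_add_of_lt hrest, m.leadingCoeff_add_of_lt hrest]
    exact ⟨hdeg, leadingCoeff_shift_monomial m k _ _⟩

theorem eq_one_of_mul_shift_eq {p q : MvPolynomial E K} (hp : p ≠ 0) (hq : q ≠ 0) {k l : E → ℤ}
    {μ : K} (h : p * shift K k q = C μ * (q * shift K l p)) : μ = 1 := by
  obtain ⟨order, hwf⟩ := exists_wellFoundedLT E
  let _ : LinearOrder E := inferInstanceAs (LinearOrder Eᵒᵈ)
  have : WellFoundedGT E := hwf
  let m : MonomialOrder E := MonomialOrder.lex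
  have hlc := congrArg m.leadingCoeff h
  simp only [m.leadingCoeff_mul, m.leadingCoeff_C, (degree_leadingCoeff_shift m _ _).2] at hlc
  rw [mul_comm (m.leadingCoeff q), eq_comm, mul_eq_right₀] at hlc
  · exact hlc
  · exact mul_ne_zero (m.leadingCoeff_ne_zero_iff.2 hp) (m.leadingCoeff_ne_zero_iff.2 hq)

/-- The linear polynomial `u_e - c`; its divisibility relation records the integral roots of a
polynomial in the variable `u_e`, which shifts translate. -/
noncomputable def linFactor (K : Type*) [Field K] (e : E) (c : ℤ) : MvPolynomial E K :=
  X e - C (c : K)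

theorem shift_linFactor (k : E → ℤ) (e : E) (c : ℤ) :
    shift K k (linFactor K e c) = linFactor K e (c + k e) := by
  rw [linFactor, linFactor, map_sub, shift_X, shift_C, Int.cast_add, map_add, sub_sub, add_comm]

theorem linFactor_dvd_shift_iff {k : E → ℤ} {e : E} {c : ℤ} {p : MvPolynomial E K} :
    linFactor K e c ∣ shift K k p ↔ linFactor K e (c - k e) ∣ p := by
  rw [← map_dvd_iff (shift K k) (a := linFactor K e (c - k e)), shift_linFactor, sub_add_cancel]

theorem prime_linFactor (e : E) (c : ℤ) : Prime (linFactor K e c) := by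
  have h : linFactor K e c = shift K (Finsupp.single e c) (X e) := by
    rw [shift_X, Finsupp.single_eq_same, linFactor]
  rw [h, MulEquiv.prime_iff]
  exact X_prime

theorem finite_linFactor_dvd [CharZero K] (e : E) {p : MvPolynomial E K} (hp : p ≠ 0) :
    {c : ℤ | linFactor K e c ∣ p}.Finite := by
  classical
  obtain ⟨v, hv⟩ : ∃ v, eval v p ≠ 0 := by
    by_contra! h
    exact hp (MvPolynomial.funext fun v => by rw [h v, map_zero])
  -- `p` restricted to the line through `v` in the direction of `u_e`
  let line : MvPolynomial E K →ₐ[K] Polynomial K :=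
    aeval (Function.update (fun f => Polynomial.C (v f)) e Polynomial.X)
  have heval : (Polynomial.aeval (v e)).comp line = aeval v := by
    ext f
    rcases eq_or_ne f e with rfl | hf
    · simp [line]
    · simp [line, Function.update_of_ne hf]
  have hline : line p ≠ 0 := fun h => hv <| by
    simpa [h, coe_aeval_eq_eval] using (DFunLike.congr_fun heval p).symm
  have hroot : ∀ c : ℤ, linFactor K e c ∣ p → (c : K) ∈ (line p).roots := by
    rintro c ⟨q, hq⟩
    rw [Polynomial.mem_roots hline, hq]
    simp [line, linFactor]
  exact ((line p).roots.toFinset.finite_toSet.preimage Int.cast_injective.injOn).subset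
    fun c hc => by simpa using hroot c hc

theorem not_forall_add_mem_or_add_mem {U : Set ℤ} (hU : U.Finite) (hne : U.Nonempty) {m n : ℤ}
    (hmn : 0 < m * n) : ¬ ∀ c ∈ U, c + m ∈ U ∨ c + n ∈ U := by
  intro h
  rcases pos_and_pos_or_neg_and_neg_of_mul_pos hmn with ⟨hm, hn⟩ | ⟨hm, hn⟩
  · obtain ⟨c, hc, hmax⟩ := Set.exists_max_image U id hU hne
    rcases h c hc with h | h <;> have := hmax _ h <;> simp only [id] at this <;> omega
  · obtain ⟨c, hc, hmin⟩ := Set.exists_min_image U id hU hne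
    rcases h c hc with h | h <;> have := hmin _ h <;> simp only [id] at this <;> omega

/-- The finite set of integral roots of `p` and `shift k q` in `u_e` would be stable under
translation by `k e` or `l e`, which have the same sign. -/
theorem mul_shift_ne_of_dvd [CharZero K] {p q : MvPolynomial E K} (hp : p ≠ 0) (hq : q ≠ 0)
    {k l : E → ℤ} {e : E} (hkl : 0 < k e * l e) (hdvd : X e ∣ p * q) {μ : K} :
    p * shift K k q ≠ C μ * (q * shift K (-l) p) := by
  intro h
  have hq' : shift K k q ≠ 0 := (map_ne_zero_iff _ (shift K k).injective).2 hq
  have hμ : IsUnit (C μ : MvPolynomial E K) := by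
    rw [isUnit_map_iff, isUnit_iff_ne_zero]
    rintro rfl
    rw [map_zero, zero_mul] at h
    exact mul_ne_zero hp hq' h
  refine not_forall_add_mem_or_add_mem
    ((finite_linFactor_dvd e hp).union (finite_linFactor_dvd e hq')) ?_ hkl fun c hc => ?_
  · have h0 : X e = linFactor K e 0 := by simp [linFactor]
    rcases (prime_linFactor e 0).dvd_or_dvd (h0 ▸ hdvd) with hdp | hdq
    · exact ⟨0, Or.inl hdp⟩
    · refine ⟨k e, Or.inr (linFactor_dvd_shift_iff.2 ?_)⟩
      rwa [sub_self]
  · have hdvd' : linFactor K e c ∣ q * shift K (-l) p := by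
      rw [← hμ.dvd_mul_left, ← h]
      exact hc.elim (·.mul_right _) (·.mul_left _)
    rcases (prime_linFactor e c).dvd_or_dvd hdvd' with hdq | hdp
    · exact Or.inl (Or.inr (linFactor_dvd_shift_iff.2 (by rwa [add_sub_cancel_right])))
    · refine Or.inr (Or.inl ?_)
      simpa using linFactor_dvd_shift_iff.1 hdp

end Multiquiver

namespace TGW

noncomputable section

/-! ### The radical of a twisted generalized Weyl construction -/

section Ring

variable {K R I : Type*} [Field K] [Ring R] [Algebra K R] {D : Datum K R I} {μ : I → I → K}

theorem Constr.base_apply (r : R) : Constr.base D μ r = Constr.gen D μ (.base r) := rfl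

theorem Constr.gen_mem_comp (g : Gen R I) : Constr.gen D μ g ∈ Constr.comp D μ g.deg :=
  Submodule.subset_span ⟨[g], by simp, by simp⟩

instance Constr.gradedMonoid_comp (D : Datum K R I) (μ : I → I → K) :
    SetLike.GradedMonoid (Constr.comp D μ) where
  one_mem := Submodule.subset_span ⟨[], by simp, by simp⟩
  mul_mem d d' a b ha hb := by
    have h : a * b ∈ Constr.comp D μ d * Constr.comp D μ d' := Submodule.mul_mem_mul ha hb
    rw [Constr.comp, Constr.comp, Submodule.span_mul_span] at h
    refine Submodule.span_mono ?_ h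
    rintro _ ⟨_, ⟨l, rfl, rfl⟩, _, ⟨l', rfl, rfl⟩, rfl⟩
    exact ⟨l ++ l', by simp, by simp⟩

instance Alg.gradedMonoid_comp (D : Datum K R I) (μ : I → I → K) :
    SetLike.GradedMonoid (Alg.comp D μ) where
  one_mem := ⟨1, SetLike.one_mem_graded _, map_one (Alg.mk D μ)⟩
  mul_mem := by
    rintro d d' _ _ ⟨a, ha, rfl⟩ ⟨b, hb, rfl⟩
    exact ⟨a * b, SetLike.mul_mem_graded ha hb, map_mul (Alg.mk D μ) a b⟩

theorem mul_mem_closure_of_forall {A : Type*} [NonUnitalNonAssocRing A] {S T U : Set A}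
    (h : ∀ s ∈ S, ∀ t ∈ T, s * t ∈ AddSubgroup.closure U) {a b : A}
    (ha : a ∈ AddSubgroup.closure S) (hb : b ∈ AddSubgroup.closure T) :
    a * b ∈ AddSubgroup.closure U := by
  have hS (t : A) (ht : t ∈ T) :
      AddSubgroup.closure S ≤ (AddSubgroup.closure U).comap (AddMonoidHom.mulRight t) :=
    (AddSubgroup.closure_le _).2 fun s hs => h s hs t ht
  have hT : AddSubgroup.closure T ≤ (AddSubgroup.closure U).comap (AddMonoidHom.mulLeft a) :=
    (AddSubgroup.closure_le _).2 fun t ht => hS t ht ha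
  exact hT hb

theorem Constr.mem_closure_homogeneous (a : Constr D μ) :
    a ∈ AddSubgroup.closure {b | ∃ d, b ∈ Constr.comp D μ d} := by
  obtain ⟨a, rfl⟩ := Constr.mk_surjective D μ a
  induction a using FreeAlgebra.induction with
  | grade0 c =>
    rw [AlgHom.commutes, Algebra.algebraMap_eq_smul_one]
    exact AddSubgroup.subset_closure ⟨0, Submodule.smul_mem _ c (SetLike.one_mem_graded _)⟩
  | grade1 g => exact AddSubgroup.subset_closure ⟨_, Constr.gen_mem_comp g⟩
  | mul a b ha hb =>
    rw [map_mul]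
    refine mul_mem_closure_of_forall ?_ ha hb
    rintro a ⟨d, ha⟩ b ⟨d', hb⟩
    exact AddSubgroup.subset_closure ⟨_, SetLike.mul_mem_graded ha hb⟩
  | add a b ha hb => rw [map_add]; exact add_mem ha hb

theorem Constr.map_mem_of_gen {B : Type*} [Ring B] [Algebra K B] {ℬ : (I →₀ ℤ) → Submodule K B}
    [SetLike.GradedMonoid ℬ] (f : Constr D μ →ₐ[K] B)
    (h : ∀ g, f (Constr.gen D μ g) ∈ ℬ g.deg) {d : I →₀ ℤ} {a : Constr D μ}
    (ha : a ∈ Constr.comp D μ d) : f a ∈ ℬ d := by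
  refine (Submodule.span_le (p := (ℬ d).comap f.toLinearMap)).2 ?_ ha
  rintro _ ⟨l, rfl, rfl⟩
  change f _ ∈ ℬ _
  rw [map_list_prod, List.map_map]
  exact SetLike.list_prod_map_mem_graded l _ _ fun g _ => h g

theorem Constr.X_mul_base (i : I) (r : R) : Constr.gen D μ (.X i) * Constr.base D μ r =
    Constr.base D μ (D.σ i r) * Constr.gen D μ (.X i) := by
  simpa [Constr.gen, Constr.base] using Constr.mk_rel (Rel.X_base (D := D) (μ := μ) i r)

theorem Constr.Y_mul_base (i : I) (r : R) : Constr.gen D μ (.Y i) * Constr.base D μ r =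
    Constr.base D μ ((D.σ i).symm r) * Constr.gen D μ (.Y i) := by
  simpa [Constr.gen, Constr.base] using Constr.mk_rel (Rel.Y_base (D := D) (μ := μ) i r)

theorem Constr.Y_mul_X (i : I) : Constr.gen D μ (.Y i) * Constr.gen D μ (.X i) =
    Constr.base D μ (D.t i) := by
  simpa [Constr.gen, Constr.base] using Constr.mk_rel (Rel.YX (D := D) (μ := μ) i)

theorem Constr.X_mul_Y (i : I) : Constr.gen D μ (.X i) * Constr.gen D μ (.Y i) =
    Constr.base D μ (D.σ i (D.t i)) := by
  simpa [Constr.gen, Constr.base] using Constr.mk_rel (Rel.XY (D := D) (μ := μ) i)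

theorem Constr.X_mul_Y_ne {i j : I} (h : i ≠ j) :
    Constr.gen D μ (.X i) * Constr.gen D μ (.Y j) =
      μ i j • (Constr.gen D μ (.Y j) * Constr.gen D μ (.X i)) := by
  simpa [Constr.gen] using Constr.mk_rel (Rel.XY_ne (D := D) (μ := μ) i j h)

variable (D μ) in
/-- The product of the generators `X i` along a list of indices. -/
def Constr.XWord (l : List I) : Constr D μ := (l.map fun i => Constr.gen D μ (.X i)).prod

variable (D μ) in
/-- The product of the generators `Y i` along a list of indices. -/
def Constr.YWord (l : List I) : Constr D μ := (l.map fun i => Constr.gen D μ (.Y i)).prod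

theorem Constr.XWord_nil : Constr.XWord D μ [] = 1 := rfl

theorem Constr.YWord_nil : Constr.YWord D μ [] = 1 := rfl

theorem Constr.XWord_cons (i : I) (l : List I) :
    Constr.XWord D μ (i :: l) = Constr.gen D μ (.X i) * Constr.XWord D μ l := by
  simp [Constr.XWord]

theorem Constr.YWord_cons (i : I) (l : List I) :
    Constr.YWord D μ (i :: l) = Constr.gen D μ (.Y i) * Constr.YWord D μ l := by
  simp [Constr.YWord]

theorem Constr.YWord_concat (l : List I) (i : I) :
    Constr.YWord D μ (l ++ [i]) = Constr.YWord D μ l * Constr.gen D μ (.Y i) := by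
  simp [Constr.YWord]

theorem Constr.YWord_mul_base (l : List I) (r : R) :
    ∃ s, Constr.YWord D μ l * Constr.base D μ r = Constr.base D μ s * Constr.YWord D μ l := by
  induction l with
  | nil => exact ⟨r, by simp [Constr.YWord_nil]⟩
  | cons i l ih =>
    obtain ⟨s, hs⟩ := ih
    exact ⟨(D.σ i).symm s, by
      rw [Constr.YWord_cons, mul_assoc, hs, ← mul_assoc, Constr.Y_mul_base, mul_assoc]⟩

theorem Constr.X_mul_YWord [DecidableEq I] (i : I) (l : List I) :
    (∃ r, Constr.gen D μ (.X i) * Constr.YWord D μ l =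
      Constr.base D μ r * (Constr.YWord D μ l * Constr.gen D μ (.X i))) ∨
    (i ∈ l ∧ ∃ r, Constr.gen D μ (.X i) * Constr.YWord D μ l =
      Constr.base D μ r * Constr.YWord D μ (l.erase i)) := by
  induction l with
  | nil => exact Or.inl ⟨1, by simp [Constr.YWord_nil]⟩
  | cons j l ih =>
    rw [Constr.YWord_cons, ← mul_assoc]
    rcases eq_or_ne i j with rfl | h
    · exact Or.inr ⟨List.mem_cons_self, D.σ i (D.t i), by
        rw [Constr.X_mul_Y, List.erase_cons_head]⟩
    · rw [Constr.X_mul_Y_ne h, smul_mul_assoc, mul_assoc]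
      rcases ih with ⟨r, hr⟩ | ⟨hi, r, hr⟩
      · refine Or.inl ⟨μ i j • (D.σ j).symm r, ?_⟩
        rw [hr, ← mul_assoc, Constr.Y_mul_base, map_smul, smul_mul_assoc]
        simp only [mul_assoc]
      · refine Or.inr ⟨List.mem_cons_of_mem _ hi, μ i j • (D.σ j).symm r, ?_⟩
        rw [hr, ← mul_assoc, Constr.Y_mul_base, map_smul, smul_mul_assoc,
          List.erase_cons_tail (by simpa using h.symm), Constr.YWord_cons, mul_assoc]

theorem Constr.Y_mul_XWord [DecidableEq I] (hμ : ∀ i j, i ≠ j → μ i j ≠ 0) {j : I} {l : List I}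
    (hj : j ∈ l) : ∃ r, Constr.gen D μ (.Y j) * Constr.XWord D μ l =
      Constr.base D μ r * Constr.XWord D μ (l.erase j) := by
  induction l with
  | nil => simp at hj
  | cons i l ih =>
    rw [Constr.XWord_cons, ← mul_assoc]
    rcases eq_or_ne i j with rfl | h
    · exact ⟨D.t i, by rw [Constr.Y_mul_X, List.erase_cons_head]⟩
    · obtain ⟨r, hr⟩ := ih ((List.mem_cons.1 hj).resolve_left h.symm)
      have hYX : Constr.gen D μ (.Y j) * Constr.gen D μ (.X i) =
          (μ i j)⁻¹ • (Constr.gen D μ (.X i) * Constr.gen D μ (.Y j)) := by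
        rw [Constr.X_mul_Y_ne h, inv_smul_smul₀ (hμ i j h)]
      refine ⟨(μ i j)⁻¹ • D.σ i r, ?_⟩
      rw [hYX, smul_mul_assoc, mul_assoc, hr, ← mul_assoc, Constr.X_mul_base, map_smul,
        smul_mul_assoc, List.erase_cons_tail (by simpa using h), Constr.XWord_cons, mul_assoc]

/-- The degree of the product of the generators `X i` along a list of indices. -/
def listDeg (l : List I) : I →₀ ℤ := (l.map fun i => Finsupp.single i 1).sum

theorem listDeg_nil : listDeg ([] : List I) = 0 := rfl

theorem listDeg_cons (i : I) (l : List I) :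
    listDeg (i :: l) = Finsupp.single i 1 + listDeg l := by
  simp [listDeg]

theorem listDeg_apply [DecidableEq I] (l : List I) (i : I) : listDeg l i = l.count i := by
  induction l with
  | nil => simp [listDeg_nil]
  | cons j l ih =>
    rw [listDeg_cons, Finsupp.add_apply, ih, List.count_cons, Finsupp.single_apply]
    by_cases h : j = i <;> simp [h, add_comm]

theorem perm_of_listDeg_eq {a b : List I} (h : listDeg a = listDeg b) : a.Perm b := by
  classical
  refine List.perm_iff_count.2 fun i => ?_
  have hi := DFunLike.congr_fun h i
  rwa [listDeg_apply, listDeg_apply, Nat.cast_inj] at hi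

theorem listDeg_erase [DecidableEq I] {i : I} {l : List I} (h : i ∈ l) :
    listDeg (l.erase i) = listDeg l - Finsupp.single i 1 := by
  have hl : listDeg l = listDeg (i :: l.erase i) :=
    ((List.perm_cons_erase h).map _).sum_eq
  rw [hl, listDeg_cons, add_sub_cancel_left]

theorem Constr.exists_prod_gen_eq_YWord_mul_XWord (l : List (Gen R I)) :
    ∃ (r : R) (a b : List I),
      (l.map (Constr.gen D μ)).prod =
        Constr.base D μ r * (Constr.YWord D μ a * Constr.XWord D μ b) ∧
      (l.map Gen.deg).sum = listDeg b - listDeg a := by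
  classical
  induction l with
  | nil => exact ⟨1, [], [], by simp [Constr.YWord_nil, Constr.XWord_nil], by simp⟩
  | cons g l ih =>
    obtain ⟨r, a, b, h, hdeg⟩ := ih
    simp only [List.map_cons, List.prod_cons, List.sum_cons, h, hdeg]
    cases g with
    | base s =>
      exact ⟨s * r, a, b, by rw [← Constr.base_apply, map_mul, mul_assoc], by simp [Gen.deg]⟩
    | Y i =>
      refine ⟨(D.σ i).symm r, i :: a, b, ?_, ?_⟩
      · rw [← mul_assoc, Constr.Y_mul_base, Constr.YWord_cons]
        simp only [mul_assoc]
      · rw [listDeg_cons, Gen.deg]; abel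
    | X i =>
      rw [← mul_assoc, Constr.X_mul_base, mul_assoc, ← mul_assoc (Constr.gen D μ (.X i))]
      rcases Constr.X_mul_YWord (D := D) (μ := μ) i a with ⟨s, hs⟩ | ⟨hi, s, hs⟩
      · refine ⟨D.σ i r * s, a, i :: b, ?_, ?_⟩
        · rw [hs, Constr.XWord_cons, map_mul]
          simp only [mul_assoc]
        · rw [listDeg_cons, Gen.deg]; abel
      · refine ⟨D.σ i r * s, a.erase i, b, ?_, ?_⟩
        · rw [hs, map_mul]
          simp only [mul_assoc]
        · rw [listDeg_erase hi, Gen.deg]; abel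

theorem Constr.YWord_mul_XWord_of_perm (hμ : ∀ i j, i ≠ j → μ i j ≠ 0) {a b : List I}
    (h : a.Perm b) : ∃ r, Constr.YWord D μ a * Constr.XWord D μ b = Constr.base D μ r := by
  classical
  induction a using List.reverseRecOn generalizing b with
  | nil =>
    rw [List.nil_perm.1 h]
    exact ⟨1, by simp [Constr.YWord_nil, Constr.XWord_nil]⟩
  | append_singleton a j ih =>
    have hj : j ∈ b := h.subset (by simp)
    have hp : a.Perm (b.erase j) :=
      ((List.perm_append_singleton j a).symm.trans h |>.trans
        (List.perm_cons_erase hj)).cons_inv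
    obtain ⟨r, hr⟩ := Constr.Y_mul_XWord (D := D) hμ hj
    obtain ⟨s, hs⟩ := Constr.YWord_mul_base (D := D) (μ := μ) a r
    obtain ⟨q, hq⟩ := ih hp
    refine ⟨s * q, ?_⟩
    rw [Constr.YWord_concat, mul_assoc, hr, ← mul_assoc, hs, mul_assoc, hq, map_mul]

theorem Constr.comp_zero_le_range_base (hμ : ∀ i j, i ≠ j → μ i j ≠ 0) :
    Constr.comp D μ 0 ≤ LinearMap.range (Constr.base D μ).toLinearMap := by
  refine Submodule.span_le.2 ?_
  rintro _ ⟨l, hl, rfl⟩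
  obtain ⟨r, a, b, h, hdeg⟩ := Constr.exists_prod_gen_eq_YWord_mul_XWord (D := D) (μ := μ) l
  rw [hl, eq_comm, sub_eq_zero] at hdeg
  obtain ⟨s, hs⟩ := Constr.YWord_mul_XWord_of_perm (D := D) hμ (perm_of_listDeg_eq hdeg.symm)
  refine ⟨r * s, ?_⟩
  rw [h, hs, AlgHom.toLinearMap_apply, map_mul]

/-- The largest graded ideal contained in the kernel of a homomorphism. -/
def gradedKer {B : Type*} [Ring B] (ψ : Constr D μ →+* B) : Ideal (Constr D μ) where
  carrier := AddSubgroup.closure {b | ψ b = 0 ∧ ∃ d, b ∈ Constr.comp D μ d}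
  add_mem' := add_mem
  zero_mem' := zero_mem _
  smul_mem' c a ha := by
    refine mul_mem_closure_of_forall ?_ (Constr.mem_closure_homogeneous c) ha
    rintro a ⟨d, ha⟩ b ⟨hb0, d', hb⟩
    exact AddSubgroup.subset_closure
      ⟨by rw [map_mul, hb0, mul_zero], _, SetLike.mul_mem_graded ha hb⟩

theorem gradedKer_isTwoSided {B : Type*} [Ring B] (ψ : Constr D μ →+* B) :
    (gradedKer ψ).IsTwoSided where
  mul_mem_of_left {a} c ha := by
    refine mul_mem_closure_of_forall ?_ ha (Constr.mem_closure_homogeneous c)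
    rintro a ⟨ha0, d, ha⟩ b ⟨d', hb⟩
    exact AddSubgroup.subset_closure
      ⟨by rw [map_mul, ha0, zero_mul], _, SetLike.mul_mem_graded ha hb⟩

theorem mem_gradedKer {B : Type*} [Ring B] {ψ : Constr D μ →+* B} {d : I →₀ ℤ} {a : Constr D μ}
    (ha : a ∈ Constr.comp D μ d) (h : ψ a = 0) : a ∈ gradedKer ψ :=
  AddSubgroup.subset_closure ⟨h, d, ha⟩

theorem gradedKer_le_ker {B : Type*} [Ring B] (ψ : Constr D μ →+* B) :
    gradedKer ψ ≤ RingHom.ker ψ := fun _ ha =>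
  (AddSubgroup.closure_le (RingHom.ker ψ).toAddSubgroup).2 (fun _ hb => hb.1) ha

theorem isNullIdeal_gradedKer (hμ : ∀ i j, i ≠ j → μ i j ≠ 0) {B : Type*} [Ring B]
    {ψ : Constr D μ →+* B} (hψ : ∀ r, ψ (Constr.base D μ r) = 0 → r = 0) :
    IsNullIdeal (gradedKer ψ) where
  twoSided := gradedKer_isTwoSided ψ
  graded a ha := by
    have hsub : {b | ψ b = 0 ∧ ∃ d, b ∈ Constr.comp D μ d} ⊆
        {b | b ∈ gradedKer ψ ∧ ∃ d, b ∈ Constr.comp D μ d} :=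
      fun b ⟨hb0, d, hb⟩ => ⟨mem_gradedKer hb hb0, d, hb⟩
    exact AddSubgroup.closure_mono hsub ha
  zero_inter a ha ha0 := by
    obtain ⟨r, rfl⟩ := Constr.comp_zero_le_range_base hμ ha0
    rw [hψ r (gradedKer_le_ker ψ ha), map_zero]

theorem mem_radical_of_map_eq_zero (hμ : ∀ i j, i ≠ j → μ i j ≠ 0) {B : Type*} [Ring B]
    {ψ : Constr D μ →+* B} (hψ : ∀ r, ψ (Constr.base D μ r) = 0 → r = 0) {d : I →₀ ℤ}
    {a : Constr D μ} (ha : a ∈ Constr.comp D μ d) (h0 : ψ a = 0) : a ∈ radical D μ :=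
  Submodule.mem_sSup_of_mem (isNullIdeal_gradedKer hμ hψ) (mem_gradedKer ha h0)

theorem Constr.exists_mem_comp_isLeftRegular {B : Type*} [Ring B] {ψ : Constr D μ →+* B}
    (hX : ∀ i, IsLeftRegular (ψ (Constr.gen D μ (.X i))))
    (hY : ∀ i, IsLeftRegular (ψ (Constr.gen D μ (.Y i)))) (d : I →₀ ℤ) :
    ∃ c ∈ Constr.comp D μ d, IsLeftRegular (ψ c) := by
  have hadd {d d' : I →₀ ℤ} (h : ∃ c ∈ Constr.comp D μ d, IsLeftRegular (ψ c))
      (h' : ∃ c ∈ Constr.comp D μ d', IsLeftRegular (ψ c)) :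
      ∃ c ∈ Constr.comp D μ (d + d'), IsLeftRegular (ψ c) := by
    obtain ⟨c, hc, h⟩ := h
    obtain ⟨c', hc', h'⟩ := h'
    exact ⟨c * c', SetLike.mul_mem_graded hc hc', by rw [map_mul]; exact h.mul h'⟩
  have h0 : ∃ c ∈ Constr.comp D μ 0, IsLeftRegular (ψ c) :=
    ⟨1, SetLike.one_mem_graded _, by rw [map_one]; exact isRegular_one.left⟩
  induction d using Finsupp.induction_linear with
  | zero => exact h0
  | add d d' h h' => exact hadd h h'
  | single i n =>
    induction n using Int.induction_on with
    | zero => rwa [Finsupp.single_zero]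
    | succ n ih =>
      rw [Finsupp.single_add]
      exact hadd ih ⟨_, Constr.gen_mem_comp (.X i), hX i⟩
    | pred n ih =>
      rw [sub_eq_add_neg, Finsupp.single_add, Finsupp.single_neg i 1]
      exact hadd ih ⟨_, Constr.gen_mem_comp (.Y i), hY i⟩

theorem radical_le_ker_of_homogeneous {B : Type*} [Ring B] {ψ : Constr D μ →+* B}
    (h : ∀ J, IsNullIdeal J → ∀ d, ∀ a ∈ J, a ∈ Constr.comp D μ d → ψ a = 0) :
    radical D μ ≤ RingHom.ker ψ := by
  refine sSup_le fun J hJ a ha =>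
    (AddSubgroup.closure_le (RingHom.ker ψ).toAddSubgroup).2 ?_ (hJ.graded a ha)
  rintro b ⟨hb, d, hd⟩
  exact h J hJ d b hb hd

/-- A homogeneous element of a null ideal is moved into degree zero, where it vanishes, by an
element whose image is left regular. -/
theorem radical_le_ker {B : Type*} [Ring B] {ψ : Constr D μ →+* B}
    (hX : ∀ i, IsLeftRegular (ψ (Constr.gen D μ (.X i))))
    (hY : ∀ i, IsLeftRegular (ψ (Constr.gen D μ (.Y i)))) : radical D μ ≤ RingHom.ker ψ := by
  refine radical_le_ker_of_homogeneous fun J hJ d b hb hd => ?_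
  obtain ⟨c, hc, hreg⟩ := Constr.exists_mem_comp_isLeftRegular hX hY (-d)
  have hcb : c * b ∈ Constr.comp D μ 0 := neg_add_cancel d ▸ SetLike.mul_mem_graded hc hd
  refine isLeftRegular_iff_right_eq_zero_of_mul.1 hreg _ ?_
  rw [← map_mul, hJ.zero_inter _ (J.mul_mem_left c hb) hcb, map_zero]

/-! ### Homomorphisms out of a twisted generalized Weyl algebra -/

section Lift

variable {B : Type*} [Ring B] [Algebra K B]

/-- The homomorphism from the construction given by the images of the generators. -/
def Constr.lift (f : Gen R I → B)
    (hf : ∀ ⦃a b⦄, Rel D μ a b → FreeAlgebra.lift K f a = FreeAlgebra.lift K f b) :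
    Constr D μ →ₐ[K] B :=
  RingQuot.liftAlgHom K ⟨FreeAlgebra.lift K f, hf⟩

theorem Constr.lift_gen (f : Gen R I → B)
    (hf : ∀ ⦃a b⦄, Rel D μ a b → FreeAlgebra.lift K f a = FreeAlgebra.lift K f b) (g : Gen R I) :
    Constr.lift f hf (Constr.gen D μ g) = f g :=
  (RingQuot.liftAlgHom_mkAlgHom_apply K _ (s := Rel D μ) hf (fgen K g)).trans
    (FreeAlgebra.lift_ι_apply _ _)

theorem Constr.algHom_ext {f g : Constr D μ →ₐ[K] B}
    (h : ∀ x, f (Constr.gen D μ x) = g (Constr.gen D μ x)) : f = g := by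
  refine AlgHom.ext fun a => ?_
  obtain ⟨a, rfl⟩ := Constr.mk_surjective D μ a
  exact DFunLike.congr_fun (FreeAlgebra.hom_ext (f := f.comp (Constr.mk D μ))
    (g := g.comp (Constr.mk D μ)) (funext h)) a

theorem Alg.mk_eq_zero {a : Constr D μ} : Alg.mk D μ a = 0 ↔ a ∈ radical D μ :=
  Ideal.Quotient.eq_zero_iff_mem

theorem Alg.mk_gen_mem_comp (g : Gen R I) : Alg.mk D μ (Constr.gen D μ g) ∈ Alg.comp D μ g.deg :=
  ⟨_, Constr.gen_mem_comp g, rfl⟩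

/-- The homomorphism induced on the twisted generalized Weyl algebra. -/
def Alg.lift (ψ : Constr D μ →ₐ[K] B) (hψ : ∀ a ∈ radical D μ, ψ a = 0) : Alg D μ →ₐ[K] B :=
  Ideal.Quotient.liftₐ (radical D μ) ψ hψ

theorem Rel.exists_lift_mem {ℬ : (I →₀ ℤ) → Submodule K B} [SetLike.GradedMonoid ℬ]
    {f : Gen R I → B} (hf : ∀ g, f g ∈ ℬ g.deg) {a b : FreeAlgebra K (Gen R I)}
    (h : Rel D μ a b) : ∃ d, FreeAlgebra.lift K f a ∈ ℬ d ∧ FreeAlgebra.lift K f b ∈ ℬ d := by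
  have hbase (r : R) : f (.base r) ∈ ℬ 0 := hf (.base r)
  have hX (i : I) : f (.X i) ∈ ℬ (Finsupp.single i 1) := hf (.X i)
  have hY (i : I) : f (.Y i) ∈ ℬ (-Finsupp.single i 1) := hf (.Y i)
  have hmul {d d' d'' : I →₀ ℤ} {a b : B} (ha : a ∈ ℬ d) (hb : b ∈ ℬ d') (hd : d + d' = d'') :
      a * b ∈ ℬ d'' := hd ▸ SetLike.mul_mem_graded ha hb
  induction h <;> simp only [map_add, map_mul, map_smul, map_one, FreeAlgebra.lift_ι_apply,
    Algebra.algebraMap_eq_smul_one]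
  case base_add r s => exact ⟨0, hbase _, add_mem (hbase r) (hbase s)⟩
  case base_mul r s => exact ⟨0, hbase _, hmul (hbase r) (hbase s) (add_zero 0)⟩
  case base_scalar c => exact ⟨0, hbase _, Submodule.smul_mem _ c (SetLike.one_mem_graded ℬ)⟩
  case X_base i r =>
    exact ⟨_, hmul (hX i) (hbase r) (add_zero _), hmul (hbase _) (hX i) (zero_add _)⟩
  case Y_base i r =>
    exact ⟨_, hmul (hY i) (hbase r) (add_zero _), hmul (hbase _) (hY i) (zero_add _)⟩
  case YX i => exact ⟨0, hmul (hY i) (hX i) (neg_add_cancel _), hbase _⟩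
  case XY i => exact ⟨0, hmul (hX i) (hY i) (add_neg_cancel _), hbase _⟩
  case XY_ne i j _ =>
    exact ⟨_, hmul (hX i) (hY j) rfl, Submodule.smul_mem _ _ (hmul (hY j) (hX i) (add_comm _ _))⟩

/-- All defining relations are homogeneous, so when `ρ` detects the homogeneous elements of `B`
they need only be checked after applying `ρ`, and likewise for the elements of the radical. -/
theorem Alg.exists_lift {C : Type*} [Ring C] [Algebra K C] {ℬ : (I →₀ ℤ) → Submodule K B}
    [SetLike.GradedMonoid ℬ] {ρ : B →ₐ[K] C} (hρ : ∀ d, ∀ b ∈ ℬ d, ρ b = 0 → b = 0)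
    (ψ : Alg D μ →ₐ[K] C) {f : Gen R I → B} (hf : ∀ g, f g ∈ ℬ g.deg)
    (hψ : ∀ g, ρ (f g) = ψ (Alg.mk D μ (Constr.gen D μ g))) :
    ∃ ξ : Alg D μ →ₐ[K] B, (∀ g, ξ (Alg.mk D μ (Constr.gen D μ g)) = f g) ∧
      (∀ d, ∀ a ∈ Alg.comp D μ d, ξ a ∈ ℬ d) ∧ ∀ a, ρ (ξ a) = ψ a := by
  have hfree (a : FreeAlgebra K (Gen R I)) :
      ρ (FreeAlgebra.lift K f a) = ψ (Alg.mk D μ (Constr.mk D μ a)) :=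
    DFunLike.congr_fun (FreeAlgebra.hom_ext (f := ρ.comp (FreeAlgebra.lift K f))
      (g := (ψ.comp (Alg.mk D μ)).comp (Constr.mk D μ)) (funext fun g =>
        (congrArg ρ (FreeAlgebra.lift_ι_apply f g)).trans (hψ g))) a
  have hrel ⦃a b : FreeAlgebra K (Gen R I)⦄ (h : Rel D μ a b) :
      FreeAlgebra.lift K f a = FreeAlgebra.lift K f b := by
    obtain ⟨d, ha, hb⟩ := h.exists_lift_mem hf
    refine sub_eq_zero.1 (hρ d _ (sub_mem ha hb) ?_)
    rw [map_sub, hfree, hfree, Constr.mk_rel h, sub_self]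
  have hcomp (a : Constr D μ) : ρ (Constr.lift f hrel a) = ψ (Alg.mk D μ a) :=
    DFunLike.congr_fun (Constr.algHom_ext (f := ρ.comp (Constr.lift f hrel))
      (g := ψ.comp (Alg.mk D μ)) fun g =>
        (congrArg ρ (Constr.lift_gen f hrel g)).trans (hψ g)) a
  have hmem {d : I →₀ ℤ} {a : Constr D μ} (ha : a ∈ Constr.comp D μ d) :
      Constr.lift f hrel a ∈ ℬ d :=
    Constr.map_mem_of_gen _ (fun g => (Constr.lift_gen f hrel g).symm ▸ hf g) ha
  have hker : radical D μ ≤ RingHom.ker (Constr.lift f hrel : Constr D μ →+* B) :=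
    radical_le_ker_of_homogeneous fun J hJ d a ha hd => hρ d _ (hmem hd) <| by
      rw [RingHom.coe_coe, hcomp, Alg.mk_eq_zero.2 (Submodule.mem_sSup_of_mem hJ ha), map_zero]
  refine ⟨Alg.lift (Constr.lift f hrel) hker, Constr.lift_gen f hrel, ?_, ?_⟩
  · rintro d _ ⟨a, ha, rfl⟩
    exact hmem ha
  · intro a
    obtain ⟨a, rfl⟩ := Ideal.Quotient.mk_surjective a
    exact hcomp a

end Lift

end Ring

section Involution

variable {K R I B : Type*} [Field K] [CommRing R] [Algebra K R] [Ring B] [Algebra K B]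
  {D : Datum K R I} {μ : I → I → K}

theorem Alg.map_inv_of_gen (hμ : ∀ i j, i ≠ j → μ i j = μ j i) (k : Alg D μ →ₐ[K] B)
    (S : RingInvolution R B) (hS : ∀ c, S.inv (algebraMap K B c) = algebraMap K B c)
    (hk : ∀ g : Gen R I, k (Alg.mk D μ (Constr.gen D μ g.swap)) =
      S.inv (k (Alg.mk D μ (Constr.gen D μ g)))) (a : Alg D μ) :
    k (Alg.inv D μ hμ a) = S.inv (k a) := by
  obtain ⟨a, rfl⟩ := Alg.mk_surjective D μ a
  obtain ⟨a, rfl⟩ := Constr.mk_surjective D μ a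
  rw [Alg.inv_mk]
  induction a using FreeAlgebra.induction with
  | grade0 c =>
    rw [AlgHom.commutes, Constr.inv_algebraMap, AlgHom.commutes, AlgHom.commutes, hS]
  | grade1 g =>
    change k (Alg.mk D μ (Constr.inv D μ hμ (Constr.gen D μ g))) =
      S.inv (k (Alg.mk D μ (Constr.gen D μ g)))
    rw [Constr.inv_gen, hk]
  | mul a b ha hb => simp only [map_mul, Constr.inv_mul, S.inv_mul, ha, hb]
  | add a b ha hb => simp only [map_add, ha, hb]

end Involution

end

end TGW

/-! ### Multiquivers and their incidence matrices -/

namespace Multiquiver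

noncomputable section

variable {V E : Type*}

theorem mult_some_self (v : V) (n : ℕ+) : mult v (some (v, n)) = n := by simp [mult]

theorem mult_nonneg (v : V) (o : Option (V × ℕ+)) : 0 ≤ mult v o := by
  rcases o with _ | ⟨w, n⟩
  · exact le_rfl
  · simp only [mult]; split_ifs <;> simp

theorem mult_sub_mult_eq_coe_iff {v : V} {o o' : Option (V × ℕ+)}
    (h : ∀ m m', o = some (v, m) → o' ≠ some (v, m')) {n : ℕ+} :
    mult v o - mult v o' = n ↔ o = some (v, n) := by
  have ho' {m : ℕ+} (hm : o = some (v, m)) : mult v o' = 0 :=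
    not_imp_comm.1 mult_ne_zero fun ⟨m', hm'⟩ => h m m' hm hm'
  constructor
  · intro hn
    have hpos := n.pos
    have hnonneg := mult_nonneg v o'
    obtain ⟨m, hm⟩ := mult_ne_zero (v := v) (o := o) (by omega)
    rw [ho' hm, hm, mult_some_self, sub_zero] at hn
    rw [hm, PNat.eq (Int.ofNat_inj.1 hn)]
  · intro hn
    rw [ho' hn, hn, mult_some_self, sub_zero]

theorem γ_apply (Γ : Multiquiver V E) (v : V) (e : E) :
    Γ.γ v e = mult v (Γ.t e) - mult v (Γ.s e) := rfl

theorem γ_eq_coe_iff (Γ : Multiquiver V E) {v : V} {e : E} {n : ℕ+} :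
    Γ.γ v e = (n : ℤ) ↔ Γ.t e = some (v, n) :=
  mult_sub_mult_eq_coe_iff fun _ _ ht hs => Γ.no_loops e _ _ _ _ hs ht rfl

theorem γ_eq_neg_coe_iff (Γ : Multiquiver V E) {v : V} {e : E} {n : ℕ+} :
    Γ.γ v e = -(n : ℤ) ↔ Γ.s e = some (v, n) := by
  rw [← neg_eq_iff_eq_neg, γ_apply, neg_sub]
  exact mult_sub_mult_eq_coe_iff fun _ _ hs ht => Γ.no_loops e _ _ _ _ hs ht rfl

theorem exists_eq_coe_pnat {n : ℤ} (h : 0 < n) : ∃ m : ℕ+, n = (m : ℤ) :=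
  ⟨⟨n.toNat, by omega⟩, by simp [h.le]⟩

theorem exists_eq_neg_coe_pnat {n : ℤ} (h : n < 0) : ∃ m : ℕ+, n = -(m : ℤ) :=
  (exists_eq_coe_pnat (neg_pos.2 h)).imp fun _ => neg_eq_iff_eq_neg.1

theorem eq_of_coe_pnat_iff {m n : ℤ} (hpos : ∀ k : ℕ+, m = k ↔ n = k)
    (hneg : ∀ k : ℕ+, m = -k ↔ n = -k) : m = n := by
  rcases lt_trichotomy m 0 with h | h | h
  · obtain ⟨k, hk⟩ := exists_eq_neg_coe_pnat h
    rw [hk, (hneg k).1 hk]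
  · rcases lt_trichotomy n 0 with h' | h' | h'
    · obtain ⟨k, hk⟩ := exists_eq_neg_coe_pnat h'
      rw [hk, (hneg k).2 hk]
    · rw [h, h']
    · obtain ⟨k, hk⟩ := exists_eq_coe_pnat h'
      rw [hk, (hpos k).2 hk]
  · obtain ⟨k, hk⟩ := exists_eq_coe_pnat h
    rw [hk, (hpos k).1 hk]

theorem γ_injective : Function.Injective (γ : Multiquiver V E → V → E →₀ ℤ) := by
  intro Γ Γ' h
  have ht : Γ.t = Γ'.t := funext fun e => Option.ext fun p => by
    rw [← γ_eq_coe_iff, ← γ_eq_coe_iff, h]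
  have hs : Γ.s = Γ'.s := funext fun e => Option.ext fun p => by
    rw [← γ_eq_neg_coe_iff, ← γ_eq_neg_coe_iff, h]
  cases Γ
  cases Γ'
  simp_all only

theorem γ_mul_γ_nonpos (Γ : Multiquiver V E) {v w : V} (h : v ≠ w) (e : E) :
    Γ.γ v e * Γ.γ w e ≤ 0 := by
  by_contra! hpos
  rcases pos_and_pos_or_neg_and_neg_of_mul_pos hpos with ⟨hv, hw⟩ | ⟨hv, hw⟩
  · obtain ⟨m, hm⟩ := exists_eq_coe_pnat hv
    obtain ⟨n, hn⟩ := exists_eq_coe_pnat hw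
    rw [γ_eq_coe_iff] at hm hn
    exact h (congrArg Prod.fst (Option.some_inj.1 (hm.symm.trans hn)))
  · obtain ⟨m, hm⟩ := exists_eq_neg_coe_pnat hv
    obtain ⟨n, hn⟩ := exists_eq_neg_coe_pnat hw
    rw [γ_eq_neg_coe_iff] at hm hn
    exact h (congrArg Prod.fst (Option.some_inj.1 (hm.symm.trans hn)))

open Classical in
/-- The end of the edge `e` prescribed by the columns `k` of an incidence matrix: the target for
`ε = 1` and the source for `ε = -1`. -/
def endOfColumns (k : V → E →₀ ℤ) (ε : ℤ) (e : E) : Option (V × ℕ+) :=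
  if h : ∃ p : V × ℕ+, k p.1 e = ε * p.2 then some h.choose else none

theorem endOfColumns_eq_some_iff {k : V → E →₀ ℤ}
    (hk : ∀ v w, v ≠ w → ∀ e, k v e * k w e ≤ 0) {ε : ℤ} (hε : ε ≠ 0) {e : E} {v : V}
    {n : ℕ+} : endOfColumns k ε e = some (v, n) ↔ k v e = ε * n := by
  have hunique {w : V} {m : ℕ+} (hv : k v e = ε * n) (hw : k w e = ε * m) :
      (w, m) = (v, n) := by
    obtain rfl : w = v := by
      by_contra hne
      have hpos : 0 < ε * ε * ((m : ℤ) * n) := mul_pos (mul_self_pos.2 hε) (by positivity)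
      refine (hk w v hne e).not_gt ?_
      rwa [hw, hv, mul_mul_mul_comm]
    rw [PNat.eq (Int.ofNat_inj.1 (mul_left_cancel₀ hε (hw.symm.trans hv)))]
  unfold endOfColumns
  split_ifs with h
  · rw [Option.some_inj]
    exact ⟨fun heq => by simpa only [heq] using h.choose_spec,
      fun hv => hunique hv h.choose_spec⟩
  · simpa only [false_iff, reduceCtorEq] using fun hv => h ⟨(v, n), hv⟩

theorem finite_endOfColumns {k : V → E →₀ ℤ}
    (hk : ∀ v w, v ≠ w → ∀ e, k v e * k w e ≤ 0) {ε : ℤ} (hε : ε ≠ 0) (v : V) :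
    {e | ∃ n, endOfColumns k ε e = some (v, n)}.Finite := by
  refine (k v).support.finite_toSet.subset ?_
  rintro e ⟨n, hn⟩
  rw [endOfColumns_eq_some_iff hk hε] at hn
  rw [Finset.mem_coe, Finsupp.mem_support_iff, hn]
  exact mul_ne_zero hε (by positivity)

/-- The multiquiver whose incidence matrix has the columns `k`. -/
def ofColumns (k : V → E →₀ ℤ) (hk : ∀ v w, v ≠ w → ∀ e, k v e * k w e ≤ 0) :
    Multiquiver V E where
  s := endOfColumns k (-1)
  t := endOfColumns k 1
  no_loops e u m v n hs ht := by
    rw [endOfColumns_eq_some_iff hk (by decide)] at hs ht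
    rintro rfl
    have hm := m.pos
    omega
  finite_s := finite_endOfColumns hk (by decide)
  finite_t := finite_endOfColumns hk (by decide)

theorem γ_ofColumns (k : V → E →₀ ℤ) (hk : ∀ v w, v ≠ w → ∀ e, k v e * k w e ≤ 0) (v : V) :
    (ofColumns k hk).γ v = k v := by
  ext e
  refine eq_of_coe_pnat_iff (fun n => ?_) fun n => ?_
  · rw [γ_eq_coe_iff, ← one_mul (n : ℤ)]
    exact endOfColumns_eq_some_iff hk (by decide)
  · rw [γ_eq_neg_coe_iff, ← neg_one_mul (n : ℤ)]
    exact endOfColumns_eq_some_iff hk (by decide)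

/-- The additive extension `ℤ V → ℤ E` of `γ`, with values regarded as weights. -/
def weight (Γ : Multiquiver V E) : (V →₀ ℤ) →ₗ[ℤ] E → ℤ :=
  Finsupp.linearCombination ℤ fun v => (Γ.γ v : E → ℤ)

theorem weight_single_one (Γ : Multiquiver V E) (v : V) :
    Γ.weight (Finsupp.single v 1) = Γ.γ v := by
  rw [weight, Finsupp.linearCombination_single, one_smul]

end

end Multiquiver

/-! ### Maps to the Weyl algebra -/

namespace TGW

noncomputable section

open MvPolynomial Multiquiver

section Generators

variable {K R I : Type*} [Field K] [Ring R] [Algebra K R] {D : Datum K R I} {μ : I → I → K}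

theorem Alg.X_mul_base (i : I) (r : R) :
    Alg.X D μ i * Alg.base D μ r = Alg.base D μ (D.σ i r) * Alg.X D μ i :=
  congrArg (Alg.mk D μ) (Constr.X_mul_base i r)

theorem Alg.Y_mul_X (i : I) : Alg.Y D μ i * Alg.X D μ i = Alg.base D μ (D.t i) :=
  congrArg (Alg.mk D μ) (Constr.Y_mul_X i)

theorem Alg.X_mul_Y_ne {i j : I} (h : i ≠ j) :
    Alg.X D μ i * Alg.Y D μ j = μ i j • (Alg.Y D μ j * Alg.X D μ i) :=
  congrArg (Alg.mk D μ) (Constr.X_mul_Y_ne h)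

end Generators

section IsMap

variable {K V E : Type*} [Field K] {D : Datum K (MvPolynomial E K) V} {μ : V → V → K}
  {hμ : ∀ i j, i ≠ j → μ i j = μ j i} {φ : Alg D μ →+* Weyl K E}
  (hφ : (Alg.ringInvolution D μ hμ).IsMap (Weyl.ringInvolution K E) φ)

include hφ

theorem map_base_of_isMap (r : MvPolynomial E K) : φ (Alg.base D μ r) = Weyl.base K E r :=
  RingHom.congr_fun hφ.1 r

theorem map_Y_of_isMap (i : V) : φ (Alg.Y D μ i) = Weyl.inv K E (φ (Alg.X D μ i)) := by
  rw [← Alg.inv_X D μ hμ]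
  exact hφ.2 _

theorem exists_algHom_of_isMap : ∃ ψ : Alg D μ →ₐ[K] Weyl K E, ∀ a, ψ a = φ a := by
  refine ⟨AlgHom.mk φ fun c => ?_, fun _ => rfl⟩
  have hc := map_base_of_isMap hφ (algebraMap K _ c)
  rwa [(Alg.base D μ).commutes, (Weyl.base K E).commutes] at hc

theorem map_X_mul_base (i : V) (r : MvPolynomial E K) :
    φ (Alg.X D μ i) * Weyl.base K E r = Weyl.base K E (D.σ i r) * φ (Alg.X D μ i) := by
  rw [← map_base_of_isMap hφ, ← map_base_of_isMap hφ, ← map_mul, ← map_mul, Alg.X_mul_base]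

theorem map_X_mul_map_Y {i j : V} (hij : i ≠ j) :
    φ (Alg.X D μ i) * φ (Alg.Y D μ j) = μ i j • (φ (Alg.Y D μ j) * φ (Alg.X D μ i)) := by
  obtain ⟨ψ, hψ⟩ := exists_algHom_of_isMap hφ
  simp only [← hψ, ← map_mul, ← map_smul, Alg.X_mul_Y_ne hij]

theorem map_X_ne_zero (i : V) : φ (Alg.X D μ i) ≠ 0 := fun h => by
  have ht := congrArg φ (Alg.Y_mul_X (D := D) (μ := μ) i)
  rw [map_mul, h, mul_zero, map_base_of_isMap hφ, eq_comm,
    map_eq_zero_iff _ Weyl.base_injective] at ht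
  exact D.t_ne_zero i ht

theorem isConsistent_of_isMap : IsConsistent D μ := fun r s h => Weyl.base_injective <| by
  rw [← map_base_of_isMap hφ, ← map_base_of_isMap hφ, h]

end IsMap

variable {K V E : Type*} [Field K]

section MonomialImage

variable {D : Datum K (MvPolynomial E K) V} {μ : V → V → K} {hμ : ∀ i j, i ≠ j → μ i j = μ j i}
  {φ : Alg D μ →+* Weyl K E} {k : V → E →₀ ℤ} {r : V → MvPolynomial E K}

/-- The homomorphism `φ` maps every `X_i` to the nonzero monomial `r_i z^{k_i}`, and `Y_i` to its
adjoint `z^{-k_i} r_i`. -/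
structure MonomialImage (φ : Alg D μ →+* Weyl K E) (k : V → E →₀ ℤ)
    (r : V → MvPolynomial E K) : Prop where
  ne_zero : ∀ i, r i ≠ 0
  map_X : ∀ i, φ (Alg.X D μ i) = Weyl.base K E (r i) * Weyl.z K (k i)
  map_Y : ∀ i, φ (Alg.Y D μ i) = Weyl.z K (-k i) * Weyl.base K E (r i)

theorem exists_monomialImage [CharZero K]
    (hφ : (Alg.ringInvolution D μ hμ).IsMap (Weyl.ringInvolution K E) φ) :
    ∃ k r, MonomialImage φ k r := by
  choose k r _ hX using fun i =>
    Weyl.exists_eq_base_mul_z (map_X_ne_zero hφ i) (D.σ i) (map_X_mul_base hφ i)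
  refine ⟨k, r, fun i h => map_X_ne_zero hφ i ?_, hX, fun i => ?_⟩
  · rw [hX, h, map_zero, zero_mul]
  · rw [map_Y_of_isMap hφ, hX, Weyl.inv_mul, Weyl.inv_z, Weyl.inv_base]

namespace MonomialImage

theorem hasWeight_map_X (h : MonomialImage φ k r) (i : V) :
    HasWeight (Weyl.base K E) (k i) (φ (Alg.X D μ i)) := by
  rw [h.map_X, ← zero_add (k i : E → ℤ)]
  exact (HasWeight.base _).mul (Weyl.hasWeight_z _)

theorem hasWeight_map_Y (h : MonomialImage φ k r) (i : V) :
    HasWeight (Weyl.base K E) (-k i) (φ (Alg.Y D μ i)) := by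
  rw [h.map_Y, ← add_zero (-k i : E → ℤ), ← Finsupp.coe_neg]
  exact (Weyl.hasWeight_z _).mul (HasWeight.base _)

theorem act_map_X_one (h : MonomialImage φ k r) (i : V) :
    Weyl.act K E (φ (Alg.X D μ i)) 1 = r i * Weyl.zCoeff K (k i) := by
  rw [h.map_X, Weyl.act_base_mul_z, map_one, mul_one]

theorem act_map_Y_one (h : MonomialImage φ k r) (i : V) :
    Weyl.act K E (φ (Alg.Y D μ i)) 1 = Weyl.zCoeff K (-k i) * shift K (-k i) (r i) := by
  rw [h.map_Y, map_mul, Module.End.mul_apply, Weyl.act_base, mul_one, Weyl.act_z, Finsupp.coe_neg]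

theorem act_map_X_one_ne_zero (h : MonomialImage φ k r) (i : V) :
    Weyl.act K E (φ (Alg.X D μ i)) 1 ≠ 0 := by
  rw [h.act_map_X_one]
  exact mul_ne_zero (h.ne_zero i) (Weyl.zCoeff_ne_zero _)

theorem act_map_Y_one_ne_zero (h : MonomialImage φ k r) (i : V) :
    Weyl.act K E (φ (Alg.Y D μ i)) 1 ≠ 0 := by
  rw [h.act_map_Y_one]
  exact mul_ne_zero (Weyl.zCoeff_ne_zero _)
    ((map_ne_zero_iff _ (shift K _).injective).2 (h.ne_zero i))

variable (h : MonomialImage φ k r)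
  (hφ : (Alg.ringInvolution D μ hμ).IsMap (Weyl.ringInvolution K E) φ)

include h hφ

theorem μ_eq_one {i j : V} (hij : i ≠ j) : μ i j = 1 :=
  eq_one_of_mul_shift_eq (h.act_map_X_one_ne_zero i) (h.act_map_Y_one_ne_zero j)
    (Weyl.act_one_mul_shift_of_mul_eq_smul (h.hasWeight_map_X i) (h.hasWeight_map_Y j)
      (map_X_mul_map_Y hφ hij))

theorem mul_nonpos [CharZero K] (i j : V) (hij : i ≠ j) (e : E) : k i e * k j e ≤ 0 := by
  by_contra! hpos
  refine mul_shift_ne_of_dvd (h.act_map_X_one_ne_zero i) (h.act_map_Y_one_ne_zero j) hpos ?_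
    (Weyl.act_one_mul_shift_of_mul_eq_smul (h.hasWeight_map_X i) (h.hasWeight_map_Y j)
      (map_X_mul_map_Y hφ hij))
  rw [h.act_map_X_one, h.act_map_Y_one]
  rcases pos_and_pos_or_neg_and_neg_of_mul_pos hpos with ⟨-, hj⟩ | ⟨hi, -⟩
  · have hneg : (-k j) e < 0 := by rwa [Finsupp.neg_apply, neg_lt_zero]
    exact ((Weyl.X_dvd_zCoeff hneg).mul_right _).mul_left _
  · exact ((Weyl.X_dvd_zCoeff hi).mul_left _).mul_right _

end MonomialImage

end MonomialImage

/-! ### The canonical representation -/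

/-- The images of the generators under the canonical representation. -/
def repGen (K : Type*) [Field K] (Γ : Multiquiver V E) : Gen (MvPolynomial E K) V → Weyl K E
  | .base r => Weyl.base K E r
  | .X v => Weyl.z K (Γ.γ v)
  | .Y v => Weyl.z K (-Γ.γ v)

theorem repGen_rel (Γ : Multiquiver V E) ⦃a b : FreeAlgebra K (Gen (MvPolynomial E K) V)⦄
    (h : Rel (Γ.datum K) (fun _ _ => 1) a b) :
    FreeAlgebra.lift K (repGen K Γ) a = FreeAlgebra.lift K (repGen K Γ) b := by
  induction h <;> simp only [map_add, map_mul, map_smul, FreeAlgebra.lift_ι_apply, repGen,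
    AlgHom.commutes]
  case X_base v r => exact Weyl.hasWeight_z _ r
  case Y_base v r =>
    refine (Weyl.hasWeight_z _ r).trans ?_
    rw [Finsupp.coe_neg, ← shift_symm]
    rfl
  case YX v => exact Weyl.z_neg_mul_z _
  case XY v => exact Weyl.z_mul_z_neg _
  case XY_ne v w h =>
    rw [one_smul]
    refine (Weyl.z_commute fun e => ?_).eq
    rw [Finsupp.neg_apply, mul_neg, neg_nonneg]
    exact Γ.γ_mul_γ_nonpos h e

/-- The canonical representation, before passing to the quotient. -/
def constrRep (K : Type*) [Field K] (Γ : Multiquiver V E) :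
    Constr (Γ.datum K) (fun _ _ => 1) →ₐ[K] Weyl K E :=
  Constr.lift (repGen K Γ) (repGen_rel Γ)

theorem constrRep_gen (Γ : Multiquiver V E) (g : Gen (MvPolynomial E K) V) :
    constrRep K Γ (Constr.gen _ _ g) = repGen K Γ g := Constr.lift_gen _ _ _

section CharZero

variable [CharZero K]

theorem radical_le_ker_constrRep (Γ : Multiquiver V E) :
    radical (Γ.datum K) (fun _ _ => 1) ≤ RingHom.ker (constrRep K Γ) :=
  radical_le_ker (fun v => (congrArg IsLeftRegular (constrRep_gen Γ (.X v))).mpr <|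
      Weyl.isLeftRegular_z _)
    (fun v => (congrArg IsLeftRegular (constrRep_gen Γ (.Y v))).mpr <|
      Weyl.isLeftRegular_z _)

/-- The canonical representation `φ_Γ`. -/
def rep (K : Type*) [Field K] [CharZero K] (Γ : Multiquiver V E) : Γ.algebra K →ₐ[K] Weyl K E :=
  Alg.lift (constrRep K Γ) (radical_le_ker_constrRep Γ)

theorem rep_gen (Γ : Multiquiver V E) (g : Gen (MvPolynomial E K) V) :
    rep K Γ (Alg.mk _ _ (Constr.gen _ _ g)) = repGen K Γ g := constrRep_gen Γ g

theorem isCanonicalRep_rep (Γ : Multiquiver V E) :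
    Γ.IsCanonicalRep (rep K Γ : Γ.algebra K →+* Weyl K E) where
  isMap := by
    refine ⟨RingHom.ext fun r => rep_gen Γ (.base r), ?_⟩
    refine Alg.map_inv_of_gen _ (rep K Γ) (Weyl.ringInvolution K E) Weyl.inv_algebraMap fun g => ?_
    rw [rep_gen, rep_gen]
    cases g with
    | base r => exact (Weyl.inv_base r).symm
    | X v => exact (Weyl.inv_z _).symm
    | Y v => exact ((Weyl.inv_z _).trans (by rw [neg_neg]; rfl)).symm
  map_X v := rep_gen Γ (.X v)
  map_Y v := rep_gen Γ (.Y v)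

theorem eq_zero_of_rep_eq_zero {Γ : Multiquiver V E} {d : V →₀ ℤ} {a : Γ.algebra K}
    (ha : a ∈ Alg.comp (Γ.datum K) (fun _ _ => 1) d) (h : rep K Γ a = 0) : a = 0 := by
  obtain ⟨a, ha, rfl⟩ := ha
  refine Alg.mk_eq_zero.2 (mem_radical_of_map_eq_zero (fun _ _ _ => one_ne_zero)
    (ψ := (constrRep K Γ).toRingHom) (fun r hr => ?_) ha h)
  exact (map_eq_zero_iff _ Weyl.base_injective).1 ((constrRep_gen Γ (.base r)).symm.trans hr)

end CharZero

/-! ### Factorization through the algebra of a multiquiver -/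

/-- The images of the generators in `A(Γ)` under the factorization of a map with
`X_i ↦ r_i z^{γ(i)}`. -/
def factorGen (Γ : Multiquiver V E) (r : V → MvPolynomial E K) :
    Gen (MvPolynomial E K) V → Γ.algebra K
  | .base s => Alg.base _ _ s
  | .X i => Alg.base _ _ (r i) * Alg.X _ _ i
  | .Y i => Alg.Y _ _ i * Alg.base _ _ (r i)

theorem factorGen_mem_comp (Γ : Multiquiver V E) (r : V → MvPolynomial E K)
    (g : Gen (MvPolynomial E K) V) :
    factorGen Γ r g ∈ Alg.comp (Γ.datum K) (fun _ _ => 1) g.deg := by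
  have hgen := Alg.mk_gen_mem_comp (D := Γ.datum K) (μ := fun _ _ => 1)
  cases g with
  | base s => exact hgen (.base s)
  | X i =>
    exact zero_add (Gen.deg (.X i)) ▸ SetLike.mul_mem_graded (hgen (.base (r i))) (hgen (.X i))
  | Y i =>
    exact add_zero (Gen.deg (.Y i)) ▸ SetLike.mul_mem_graded (hgen (.Y i)) (hgen (.base (r i)))

theorem factorGen_swap (Γ : Multiquiver V E) (r : V → MvPolynomial E K)
    (g : Gen (MvPolynomial E K) V) :
    factorGen Γ r g.swap = (Γ.ringInvolution K).inv (factorGen Γ r g) := by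
  have hbase (s : MvPolynomial E K) :
      (Γ.ringInvolution K).inv (Alg.base _ _ s) = Alg.base _ _ s := (Γ.ringInvolution K).inv_ρ s
  have hX (i : V) : (Γ.ringInvolution K).inv (Alg.X _ _ i) = Alg.Y _ _ i := Alg.inv_X _ _ _ i
  have hY (i : V) : (Γ.ringInvolution K).inv (Alg.Y _ _ i) = Alg.X _ _ i := Alg.inv_Y _ _ _ i
  cases g <;> simp only [Gen.swap, factorGen, (Γ.ringInvolution K).inv_mul, hbase, hX, hY]

section Factors

variable {D : Datum K (MvPolynomial E K) V} {μ : V → V → K} {hμ : ∀ i j, i ≠ j → μ i j = μ j i}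
  {φ : Alg D μ →+* Weyl K E} {Γ : Multiquiver V E}

theorem MonomialImage.rep_factorGen [CharZero K] {r : V → MvPolynomial E K}
    (h : MonomialImage φ Γ.γ r)
    (hφ : (Alg.ringInvolution D μ hμ).IsMap (Weyl.ringInvolution K E) φ)
    (g : Gen (MvPolynomial E K) V) :
    rep K Γ (factorGen Γ r g) = φ (Alg.mk D μ (Constr.gen D μ g)) := by
  have hrep := isCanonicalRep_rep (K := K) Γ
  have hbase := map_base_of_isMap hrep.isMap
  cases g with
  | base s => exact (hbase s).trans (map_base_of_isMap hφ s).symm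
  | X i =>
    refine (map_mul _ _ _).trans (Eq.trans ?_ (h.map_X i).symm)
    exact congrArg₂ _ (hbase _) (hrep.map_X i)
  | Y i =>
    refine (map_mul _ _ _).trans (Eq.trans ?_ (h.map_Y i).symm)
    exact congrArg₂ _ (hrep.map_Y i) (hbase _)

theorem MonomialImage.factors [CharZero K] {r : V → MvPolynomial E K}
    (h : MonomialImage φ Γ.γ r)
    (hφ : (Alg.ringInvolution D μ hμ).IsMap (Weyl.ringInvolution K E) φ) : Γ.Factors hμ φ := by
  obtain ⟨ψ, hψ⟩ := exists_algHom_of_isMap hφ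
  obtain ⟨ξ, hgen, hgraded, hξ⟩ := Alg.exists_lift (ρ := rep K Γ)
    (ℬ := Alg.comp (Γ.datum K) fun _ _ => 1) (fun _ _ => eq_zero_of_rep_eq_zero) ψ
    (factorGen_mem_comp Γ r) fun g => (h.rep_factorGen hφ g).trans (hψ _).symm
  have hinv (a : Alg D μ) : ξ (Alg.inv D μ hμ a) = (Γ.ringInvolution K).inv (ξ a) := by
    refine Alg.map_inv_of_gen hμ ξ (Γ.ringInvolution K) (fun c => ?_) (fun g => ?_) a
    · rw [← (Alg.base (Γ.datum K) (fun _ _ => 1)).commutes]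
      exact (Γ.ringInvolution K).inv_ρ _
    · rw [hgen, hgen, factorGen_swap]
  exact ⟨_, isCanonicalRep_rep Γ, (ξ : Alg D μ →+* Γ.algebra K),
    ⟨RingHom.ext fun s => hgen (.base s), hinv⟩, hgraded,
    RingHom.ext fun a => (hξ a).trans (hψ a)⟩

end Factors

/-! ### Uniqueness of the multiquiver -/

theorem hasWeight_of_isCanonicalRep {Γ : Multiquiver V E} {φΓ : Γ.algebra K →+* Weyl K E}
    (h : Γ.IsCanonicalRep φΓ) {d : V →₀ ℤ} {a : Γ.algebra K}
    (ha : a ∈ Alg.comp (Γ.datum K) (fun _ _ => 1) d) :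
    HasWeight (Weyl.base K E) (Γ.weight d) (φΓ a) := by
  obtain ⟨a, ha, rfl⟩ := ha
  obtain ⟨ψ, hψ⟩ := exists_algHom_of_isMap h.isMap
  have : SetLike.GradedMonoid fun d => weightSpace (Weyl.base K E) (Γ.weight d) :=
    { one_mem := (map_zero Γ.weight).symm ▸ HasWeight.one
      mul_mem d d' _ _ hv hw := (map_add Γ.weight d d').symm ▸ HasWeight.mul hv hw }
  rw [← hψ]
  refine Constr.map_mem_of_gen (ψ.comp (Alg.mk _ _))
    (ℬ := fun d => weightSpace (Weyl.base K E) (Γ.weight d)) (fun g => ?_) ha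
  change HasWeight _ _ (ψ (Alg.mk _ _ (Constr.gen _ _ g)))
  rw [hψ]
  cases g with
  | base r =>
    rw [Gen.deg, map_zero]
    exact (map_base_of_isMap h.isMap r).symm ▸ HasWeight.base r
  | X v =>
    rw [Gen.deg, weight_single_one]
    exact (h.map_X v).symm ▸ Weyl.hasWeight_z _
  | Y v =>
    rw [Gen.deg, map_neg, weight_single_one, ← Finsupp.coe_neg]
    exact (h.map_Y v).symm ▸ Weyl.hasWeight_z _

theorem hasWeight_map_X_of_factors {D : Datum K (MvPolynomial E K) V} {μ : V → V → K}
    {hμ : ∀ i j, i ≠ j → μ i j = μ j i} {φ : Alg D μ →+* Weyl K E} {Γ : Multiquiver V E}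
    (hΓ : Γ.Factors hμ φ) (i : V) : HasWeight (Weyl.base K E) (Γ.γ i) (φ (Alg.X D μ i)) := by
  obtain ⟨φΓ, hrep, ξ, -, hgraded, rfl⟩ := hΓ
  have h := hasWeight_of_isCanonicalRep hrep (hgraded (Finsupp.single i 1) (Alg.X D μ i)
    (Alg.mk_gen_mem_comp (.X i)))
  rwa [weight_single_one] at h

theorem eq_of_factors [CharZero K] {D : Datum K (MvPolynomial E K) V} {μ : V → V → K}
    {hμ : ∀ i j, i ≠ j → μ i j = μ j i} {φ : Alg D μ →+* Weyl K E} {Γ Γ' : Multiquiver V E}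
    (hX : ∀ i, φ (Alg.X D μ i) ≠ 0) (hΓ : Γ.Factors hμ φ) (hΓ' : Γ'.Factors hμ φ) : Γ = Γ' := by
  have hγ (i : V) : (Γ.γ i : E → ℤ) = Γ'.γ i := by
    have h := hasWeight_map_X_of_factors hΓ i
    have h' := hasWeight_map_X_of_factors hΓ' i
    exact Weyl.weight_unique h h' (hX i)
  exact γ_injective <| funext fun i => DFunLike.coe_injective (hγ i)

end

end TGW

theorem theorem4p11 {K V E : Type*} [Field K] [CharZero K]
    (D : TGW.Datum K (MvPolynomial E K) V) (μ : V → V → K)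
    (hμ0 : ∀ i j, i ≠ j → μ i j ≠ 0) (hμ : ∀ i j, i ≠ j → μ i j = μ j i)
    (φ : TGW.Alg D μ →+* TGW.Weyl K E)
    (hφ : (TGW.Alg.ringInvolution D μ hμ).IsMap (TGW.Weyl.ringInvolution K E) φ) :
    TGW.IsConsistent D μ ∧
    (∃ Γ : Multiquiver V E, Γ.Factors hμ φ) ∧
    ((∀ i, φ (TGW.Alg.X D μ i) ≠ 0) →
      (∃! Γ : Multiquiver V E, Γ.Factors hμ φ) ∧ ∀ i j, i ≠ j → μ i j = 1) := by
  obtain ⟨k, r, h⟩ := TGW.exists_monomialImage hφ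
  obtain ⟨Γ, rfl⟩ : ∃ Γ : Multiquiver V E, Γ.γ = k :=
    ⟨Multiquiver.ofColumns k (h.mul_nonpos hφ), funext (Multiquiver.γ_ofColumns k _)⟩
  have hΓ : Γ.Factors hμ φ := h.factors hφ
  exact ⟨TGW.isConsistent_of_isMap hφ, ⟨Γ, hΓ⟩, fun hX =>
    ⟨⟨Γ, hΓ, fun Γ' hΓ' => TGW.eq_of_factors hX hΓ' hΓ⟩, fun i j hij => h.μ_eq_one hφ hij⟩⟩
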